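/- **Theorem 3.** *Setting.* An instance consists of a finite metric space $(V,\ell)$ of locations, a finite set $B$ of passengers, a finite set $T$ of taxicabs, a profile $P$ (a partition of $B$ into sets $P_v$, $v\in V$; $\mathrm{loc}(b)$ is the location of $b$) and a current supply $s$ (a partition of $T$ into sets $s_v$, $v\in V$). Each passenger $b$ has a value $\mathrm{val}(b)\ge 0$. For surge prices $r\in\mathbb{R}_{\ge 0}^V$ the demand at $v$ is $d_v(r_v)=\{b\in P_v:\mathrm{val}(b)\ge r_v\}$. For a new supply $s'$ (another partition of $T$ indexed by $V$), the set of served passengers consists, at each $v$, of $\min(|d_v(r_v)|,|s'_v|)$ highest valued passengers of $d_v(r_v)$, ties being broken arbitrarily. A flow from $s$ to $s'$ is a function $f:V\times V\to\mathbb{Z}_{\ge 0}$ with $\sum_v f(u,v)=|s_u|$ for all $u$ and $\sum_u f(u,v)=|s'_v|$ for all $v$; its cost is $\sum_{u,v}f(u,v)\,\ell_{u,v}$, and $em(s,s')$ is the minimal cost of a flow from $s$ to $s'$. The social welfare is the sum of the values of the served passengers minus $em(s,s')$. The utility of a taxicab that moves from $u$ to $v$ is $$\mu(u\mapsto v)=\frac{\min(|d_v(r_v)|,|s'_v|)}{|s'_v|}\,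 r_v-\ell_{u,v},$$ where the fraction is read as $1$ if $s'_v=\emptyset$. The tuple $(s,s',d(r),r)$ is in *passenger-taxicab equilibrium* if for every min cost flow $f$ from $s$ to $s'$ and all $u,v$ with $f(u,v)>0$ we have $\mu(u\mapsto v)=\max_{w\in V}\mu(u\mapsto w)$, and, however ties are broken, all passengers $b$ with $\mathrm{val}(b)>r_{\mathrm{loc}(b)}$ are served and no passenger $b$ with $\mathrm{val}(b)<r_{\mathrm{loc}(b)}$ is served. *Claim.* There is a rule that determines, from any instance and any values $\ge 0$ (reported by the passengers), surge prices $r\ge 0$ and a new supply $s'$ such that the following hold. 1. For every instance and all values, $s$, $s'$, $d(r)$ and $r$ are in passenger-taxicab equilibrium. 2. For every instance and all values, $s'$ (with $r$) maximizes social welfare: no new supply, with any surge prices, has a larger social welfare. 3. The surge prices are computable in polynomial time: there are a fixed program of a random access machine over the reals (unit-cost addition, subtraction, comparison, copying and indirect addressing; no multiplication or rounding) and a polynomial $p$ such that on every instance and all values the program computes all the prices $r_v$, $v\in V$, in at most $(|V|+1)\cdot p(|B|+|T|)$ steps. 4. Reporting the true value is a dominant strategy for each passenger: let the utility of a passenger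 $b$ with true value $x$ be $x-r_{\mathrm{loc}(b)}$ if $b$ is served and $0$ otherwise, where $r$, $s'$ and the set of served passengers are determined by the reports. Then for all reports of the others, all true values $x\ge0$ and all misreports $y\ge 0$, the utility of $b$ from reporting $x$ is at least the utility from reporting $y$, however ties are broken in the two outcomes. -/

import Mathlib

namespace Taxi

open Finset

/-! ### Networks, profiles, supplies, flows -/

/-- A discrete passenger-taxicab setting, without the values of the passengers: a finite metric
space with points `Fin k` and distances `ℓ`, passengers `Fin m`, taxicabs `Fin n`, the profile
(every passenger has a location) and the current supply (every taxicab has a location). -/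
structure Setting where
  /-- number of locations -/
  k : ℕ
  /-- number of passengers -/
  m : ℕ
  /-- number of taxicabs -/
  n : ℕ
  /-- distances -/
  ℓ : Fin k → Fin k → ℝ
  ℓ_nonneg : ∀ u v, 0 ≤ ℓ u v
  ℓ_eq_zero : ∀ u v, ℓ u v = 0 ↔ u = v
  ℓ_comm : ∀ u v, ℓ u v = ℓ v u
  ℓ_triangle : ∀ u v w, ℓ u w ≤ ℓ u v + ℓ v w
  /-- the profile: `P_v` is the set of passengers `i` with `profile i = v` -/
  profile : Fin m → Fin k
  /-- the current supply: `s_v` is the set of taxicabs `j` with `supply j = v` -/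
  supply : Fin n → Fin k

namespace Setting

variable (I : Setting)

/-- A supply `⟨s_v⟩_v` partitions the taxicabs among the locations; it is given by the map that
sends each taxicab to its location. -/
abbrev Supply : Type := Fin I.n → Fin I.k

/-- The passengers' values (true or reported). -/
abbrev Values : Type := Fin I.m → ℝ

/-- A price for each location. -/
abbrev Prices : Type := Fin I.k → ℝ

variable {I}

/-- The set `s_v` of the taxicabs at `v` under the supply `s`. -/
def taxisAt (s : I.Supply) (v : Fin I.k) : Finset (Fin I.n) := {j | s j = v}

/-- The demand `d_v(r_v)`: the passengers at `v` whose value is at least `r_v`. -/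
noncomputable def demand (val : I.Values) (r : I.Prices) (v : Fin I.k) : Finset (Fin I.m) :=
  {i | I.profile i = v ∧ r v ≤ val i}

/-- `f` is an (integral) flow from the supply `s` to the supply `s'`. -/
def IsFlow (s s' : I.Supply) (f : Fin I.k → Fin I.k → ℕ) : Prop :=
  (∀ u, ∑ v, f u v = #(taxisAt s u)) ∧ (∀ v, ∑ u, f u v = #(taxisAt s' v))

/-- The cost of a flow. -/
def flowCost (f : Fin I.k → Fin I.k → ℕ) : ℝ := ∑ u, ∑ v, (f u v : ℝ) * I.ℓ u v

/-- `f` is a flow of minimal cost from `s` to `s'`. -/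
def IsMinCostFlow (s s' : I.Supply) (f : Fin I.k → Fin I.k → ℕ) : Prop :=
  IsFlow s s' f ∧ ∀ g, IsFlow s s' g → flowCost f ≤ flowCost g

/-- The earthmover distance from `s` to `s'`. There always is a flow, and there are only finitely
many, so that the infimum is a minimum. -/
noncomputable def earthmover (s s' : I.Supply) : ℝ :=
  sInf {c | ∃ f, IsFlow s s' f ∧ c = flowCost f}

/-! ### Demand served, social welfare, equilibrium -/

/-- `S` is a possible set of served passengers: at every location `v` it consists of all of
`d_v(r_v)` if there are enough taxicabs at `v` in the new supply `s'`, and otherwise of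
`|s'_v|` highest valued passengers of `d_v(r_v)`, ties being broken arbitrarily. -/
def IsDemandServed (val : I.Values) (r : I.Prices) (s' : I.Supply) (S : Finset (Fin I.m)) : Prop :=
  ∀ v, {i ∈ S | I.profile i = v} ⊆ demand val r v ∧
    #{i ∈ S | I.profile i = v} = min #(demand val r v) #(taxisAt s' v) ∧
    ∀ i ∈ S, I.profile i = v → ∀ j ∈ demand val r v, j ∉ S → val j ≤ val i

/-- Tie breaking is always possible: there is a set of served passengers. -/
theorem exists_isDemandServed (val : I.Values) (r : I.Prices) (s' : I.Supply) :
    ∃ S, IsDemandServed val r s' S := by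
  have top : ∀ (D : Finset (Fin I.m)) (c : ℕ), c ≤ #D →
      ∃ A ⊆ D, #A = c ∧ ∀ i ∈ A, ∀ j ∈ D, j ∉ A → val j ≤ val i := by
    intro D c
    induction c with
    | zero => exact fun _ => ⟨∅, by simp, by simp, by simp⟩
    | succ c ih =>
      intro hc
      obtain ⟨A, hA, hcard, hmax⟩ := ih (by omega)
      have hne : (D \ A).Nonempty := by
        rw [← card_pos, card_sdiff_of_subset hA]; omega
      obtain ⟨x, hx, hxmax⟩ := exists_max_image (D \ A) val hne
      rw [mem_sdiff] at hx
      refine ⟨insert x A, insert_subset hx.1 hA, by rw [card_insert_of_notMem hx.2, hcard], ?_⟩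
      intro i hi j hj hjn
      rw [mem_insert, not_or] at hjn
      rcases mem_insert.1 hi with rfl | hi
      · exact hxmax j (mem_sdiff.2 ⟨hj, hjn.2⟩)
      · exact hmax i hi j hj hjn.2
  choose A hA hcard hmax using fun v =>
    top (demand val r v) (min #(demand val r v) #(taxisAt s' v)) (min_le_left _ _)
  have hloc : ∀ v, ∀ i ∈ A v, I.profile i = v := fun v i hi => (mem_filter.1 (hA v hi)).2.1
  have hS : ∀ v, ({i ∈ univ.biUnion A | I.profile i = v} : Finset (Fin I.m)) = A v := by
    intro v
    ext i
    simp only [mem_filter, mem_biUnion, mem_univ, true_and]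
    constructor
    · rintro ⟨⟨w, hw⟩, rfl⟩
      rwa [hloc w i hw]
    · exact fun hi => ⟨⟨v, hi⟩, hloc v i hi⟩
  refine ⟨univ.biUnion A, fun v => ⟨by rw [hS]; exact hA v, by rw [hS]; exact hcard v, ?_⟩⟩
  intro i hi hiv j hj hjn
  refine hmax v i ?_ j hj ?_
  · rw [← hS v]; exact mem_filter.2 ⟨hi, hiv⟩
  · exact fun h => hjn (mem_biUnion.2 ⟨v, mem_univ v, h⟩)

/-- Social welfare, when the supply changes from `s` to `s'` and `S` is the set of served
passengers: the sum of the values of the served passengers minus the earthmover distance. -/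
noncomputable def socialWelfare (val : I.Values) (s s' : I.Supply) (S : Finset (Fin I.m)) : ℝ :=
  ∑ i ∈ S, val i - earthmover s s'

/-- The probability `min(|d_v(r_v)|, |s'_v|) / |s'_v|` that a taxicab at `v` serves a passenger.
Where no taxicab is at `v` it is read as `1`, the value that makes a deviation to `v` the most
attractive. -/
noncomputable def serviceRate (val : I.Values) (r : I.Prices) (s' : I.Supply) (v : Fin I.k) : ℝ :=
  if #(taxisAt s' v) = 0 then 1
  else (min #(demand val r v) #(taxisAt s' v) : ℕ) / (#(taxisAt s' v) : ℝ)

/-- The utility of a taxicab that moves from `u` to `v`. -/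
noncomputable def taxiUtility (val : I.Values) (r : I.Prices) (s' : I.Supply)
    (u v : Fin I.k) : ℝ :=
  serviceRate val r s' v * r v - I.ℓ u v

/-- Passenger-taxicab equilibrium. -/
structure IsEquilibrium (val : I.Values) (s s' : I.Supply) (r : I.Prices) : Prop where
  /-- along every min cost flow, the taxicabs choose a best response -/
  best_response : ∀ f, IsMinCostFlow s s' f → ∀ u v, 0 < f u v →
    ∀ w, taxiUtility val r s' u w ≤ taxiUtility val r s' u v
  /-- passengers whose value exceeds the price are served, however ties are broken -/
  served : ∀ S, IsDemandServed val r s' S → ∀ i, r (I.profile i) < val i → i ∈ S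
  /-- passengers whose value is below the price are not served -/
  not_served : ∀ S, IsDemandServed val r s' S → ∀ i, val i < r (I.profile i) → i ∉ S

/-- The new supply `s'` with the prices `r` maximizes social welfare over all new supplies and all
surge prices. -/
def MaximizesWelfare (val : I.Values) (s s' : I.Supply) (r : I.Prices) : Prop :=
  ∀ S, IsDemandServed val r s' S →
    ∀ (s₁ : I.Supply) (r₁ : I.Prices) (S₁ : Finset (Fin I.m)), (∀ v, 0 ≤ r₁ v) →
      IsDemandServed val r₁ s₁ S₁ → socialWelfare val s s₁ S₁ ≤ socialWelfare val s s' S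

/-- The utility of passenger `i`, with true value `x`, at prices `r` when `S` is the set of served
passengers. -/
noncomputable def passengerUtility (r : I.Prices) (S : Finset (Fin I.m)) (i : Fin I.m) (x : ℝ) : ℝ :=
  if i ∈ S then x - r (I.profile i) else 0

end Setting

/-! ### Mechanisms -/

/-- A mechanism determines surge prices and a new supply from the setting and the reported
values. -/
structure Mechanism where
  price : (I : Setting) → I.Values → I.Prices
  newSupply : (I : Setting) → I.Values → I.Supply

/-- Reporting the true value is a dominant strategy for every passenger: whatever the others
report, and however ties among the passengers are broken, a passenger `i` with true value `x`
does at least as well by reporting `x` as by reporting any `y`. -/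
def Mechanism.IsTruthful (M : Mechanism) : Prop :=
  ∀ (I : Setting) (val : I.Values), (∀ i, 0 ≤ val i) →
    ∀ (i : Fin I.m) (x y : ℝ), 0 ≤ x → 0 ≤ y →
    ∀ S S₁ : Finset (Fin I.m),
      Setting.IsDemandServed (Function.update val i x) (M.price I (Function.update val i x))
        (M.newSupply I (Function.update val i x)) S →
      Setting.IsDemandServed (Function.update val i y) (M.price I (Function.update val i y))
        (M.newSupply I (Function.update val i y)) S₁ →
      Setting.passengerUtility (M.price I (Function.update val i y)) S₁ i x ≤
        Setting.passengerUtility (M.price I (Function.update val i x)) S i x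

/-! ### A random access machine over the reals

Programs of a small imperative language on arrays of natural numbers and two-dimensional arrays of
real numbers, with a count of the elementary operations. Only addition, subtraction, comparison,
copying and indirect addressing are available (no multiplication, division or rounding), each at
unit cost. -/

namespace RAM

/-- The memory: `nat a i` is entry `i` of array `a` of natural numbers, `real a i j` is
entry `(i, j)` of array `a` of real numbers. -/
structure State where
  nat : ℕ → ℕ → ℕ
  real : ℕ → ℕ → ℕ → ℝ

/-- Expressions for natural numbers (subtraction is truncated). -/
inductive NExp where
  | lit (c : ℕ)
  | cell (a : ℕ) (i : NExp)
  | add (e₁ e₂ : NExp)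
  | sub (e₁ e₂ : NExp)

/-- Expressions for real numbers. -/
inductive RExp where
  | zero
  | cell (a : ℕ) (i j : NExp)
  | add (e₁ e₂ : RExp)
  | sub (e₁ e₂ : RExp)

/-- Tests. -/
inductive Test where
  | natLe (e₁ e₂ : NExp)
  | realLe (e₁ e₂ : RExp)
  | not (b : Test)
  | and (b₁ b₂ : Test)

/-- Programs. -/
inductive Prog where
  | skip
  | setNat (a : ℕ) (i e : NExp)
  | setReal (a : ℕ) (i j : NExp) (e : RExp)
  | seq (c₁ c₂ : Prog)
  | cond (b : Test) (c₁ c₂ : Prog)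
  | loop (b : Test) (c : Prog)

def NExp.eval (σ : State) : NExp → ℕ
  | .lit c => c
  | .cell a i => σ.nat a (i.eval σ)
  | .add e₁ e₂ => e₁.eval σ + e₂.eval σ
  | .sub e₁ e₂ => e₁.eval σ - e₂.eval σ

def NExp.cost : NExp → ℕ
  | .lit _ => 1
  | .cell _ i => i.cost + 1
  | .add e₁ e₂ => e₁.cost + e₂.cost + 1
  | .sub e₁ e₂ => e₁.cost + e₂.cost + 1

noncomputable def RExp.eval (σ : State) : RExp → ℝ
  | .zero => 0
  | .cell a i j => σ.real a (i.eval σ) (j.eval σ)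
  | .add e₁ e₂ => e₁.eval σ + e₂.eval σ
  | .sub e₁ e₂ => e₁.eval σ - e₂.eval σ

def RExp.cost : RExp → ℕ
  | .zero => 1
  | .cell _ i j => i.cost + j.cost + 1
  | .add e₁ e₂ => e₁.cost + e₂.cost + 1
  | .sub e₁ e₂ => e₁.cost + e₂.cost + 1

def Test.Holds (σ : State) : Test → Prop
  | .natLe e₁ e₂ => e₁.eval σ ≤ e₂.eval σ
  | .realLe e₁ e₂ => e₁.eval σ ≤ e₂.eval σ
  | .not b => ¬ b.Holds σ
  | .and b₁ b₂ => b₁.Holds σ ∧ b₂.Holds σ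

def Test.cost : Test → ℕ
  | .natLe e₁ e₂ => e₁.cost + e₂.cost + 1
  | .realLe e₁ e₂ => e₁.cost + e₂.cost + 1
  | .not b => b.cost + 1
  | .and b₁ b₂ => b₁.cost + b₂.cost + 1

/-- Overwrite entry `i` of the natural number array `a`. -/
def State.setNat (σ : State) (a i x : ℕ) : State :=
  { σ with nat := fun a' i' => if a' = a ∧ i' = i then x else σ.nat a' i' }

/-- Overwrite entry `(i, j)` of the real array `a`. -/
noncomputable def State.setReal (σ : State) (a i j : ℕ) (x : ℝ) : State :=
  { σ with real := fun a' i' j' => if a' = a ∧ i' = i ∧ j' = j then x else σ.real a' i' j' }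

/-- `Run c σ τ t`: started in the memory `σ`, the program `c` halts in the memory `τ` after `t`
elementary operations. -/
inductive Run : Prog → State → State → ℕ → Prop
  | skip (σ : State) : Run .skip σ σ 1
  | setNat (σ : State) (a : ℕ) (i e : NExp) :
      Run (.setNat a i e) σ (σ.setNat a (i.eval σ) (e.eval σ)) (i.cost + e.cost + 1)
  | setReal (σ : State) (a : ℕ) (i j : NExp) (e : RExp) :
      Run (.setReal a i j e) σ (σ.setReal a (i.eval σ) (j.eval σ) (e.eval σ))
        (i.cost + j.cost + e.cost + 1)
  | seq {c₁ c₂ : Prog} {σ τ υ : State} {t₁ t₂ : ℕ} :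
      Run c₁ σ τ t₁ → Run c₂ τ υ t₂ → Run (.seq c₁ c₂) σ υ (t₁ + t₂)
  | cond_true {b : Test} {c₁ c₂ : Prog} {σ τ : State} {t : ℕ} :
      b.Holds σ → Run c₁ σ τ t → Run (.cond b c₁ c₂) σ τ (b.cost + t + 1)
  | cond_false {b : Test} {c₁ c₂ : Prog} {σ τ : State} {t : ℕ} :
      ¬ b.Holds σ → Run c₂ σ τ t → Run (.cond b c₁ c₂) σ τ (b.cost + t + 1)
  | loop_done {b : Test} {c : Prog} {σ : State} :
      ¬ b.Holds σ → Run (.loop b c) σ σ (b.cost + 1)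
  | loop_step {b : Test} {c : Prog} {σ τ υ : State} {t₁ t₂ : ℕ} :
      b.Holds σ → Run c σ τ t₁ → Run (.loop b c) τ υ t₂ →
      Run (.loop b c) σ υ (b.cost + t₁ + t₂ + 1)

/-- A run is determined by the program and the initial memory. -/
theorem Run.unique {c : Prog} {σ τ τ' : State} {t t' : ℕ} (h : Run c σ τ t)
    (h' : Run c σ τ' t') : τ = τ' ∧ t = t' := by
  induction h generalizing τ' t' with
  | skip | setNat | setReal => cases h'; exact ⟨rfl, rfl⟩
  | seq _ _ ih₁ ih₂ =>
    cases h' with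
    | seq a b =>
      obtain ⟨rfl, rfl⟩ := ih₁ a
      obtain ⟨rfl, rfl⟩ := ih₂ b
      exact ⟨rfl, rfl⟩
  | cond_true hb _ ih =>
    cases h' with
    | cond_true _ a => obtain ⟨rfl, rfl⟩ := ih a; exact ⟨rfl, rfl⟩
    | cond_false hn _ => exact absurd hb hn
  | cond_false hn _ ih =>
    cases h' with
    | cond_true hb _ => exact absurd hb hn
    | cond_false _ a => obtain ⟨rfl, rfl⟩ := ih a; exact ⟨rfl, rfl⟩
  | loop_done hn =>
    cases h' with
    | loop_done => exact ⟨rfl, rfl⟩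
    | loop_step hb _ _ => exact absurd hb hn
  | loop_step hb _ _ ih₁ ih₂ =>
    cases h' with
    | loop_done hn => exact absurd hb hn
    | loop_step _ a b =>
      obtain ⟨rfl, rfl⟩ := ih₁ a
      obtain ⟨rfl, rfl⟩ := ih₂ b
      exact ⟨rfl, rfl⟩

/-- The initial memory for a setting with reported values. Array 0 of naturals holds the numbers
`k, m, n` of locations, passengers and taxicabs, array 1 the locations of the passengers, array 2
those of the taxicabs; array 0 of reals holds the distances, column 0 of array 1 the reported
values. All the rest is zero. -/
noncomputable def input (I : Setting) (val : I.Values) : State where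
  nat a i :=
    if a = 0 then (if i = 0 then I.k else if i = 1 then I.m else if i = 2 then I.n else 0)
    else if a = 1 then (if h : i < I.m then (I.profile ⟨i, h⟩ : ℕ) else 0)
    else if a = 2 then (if h : i < I.n then (I.supply ⟨i, h⟩ : ℕ) else 0)
    else 0
  real a i j :=
    if a = 0 then (if h : i < I.k ∧ j < I.k then I.ℓ ⟨i, h.1⟩ ⟨j, h.2⟩ else 0)
    else if a = 1 then (if h : i < I.m ∧ j = 0 then val ⟨i, h.1⟩ else 0)
    else 0

end RAM

/-- The surge prices of the mechanism are computable in polynomial time: one fixed program computes,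
for every setting and all reported values, the prices of all locations (left in column 0 of array 2
of reals), with at most `(k + 1) * p (m + n)` operations for a fixed polynomial `p`, where `k`, `m`
and `n` are the numbers of locations, passengers and taxicabs. -/
def Mechanism.PricesPolyTime (M : Mechanism) : Prop :=
  ∃ (c : RAM.Prog) (p : Polynomial ℕ), ∀ (I : Setting) (val : I.Values), (∀ i, 0 ≤ val i) →
    ∃ (τ : RAM.State) (t : ℕ), RAM.Run c (RAM.input I val) τ t ∧
      t ≤ (I.k + 1) * p.eval (I.m + I.n) ∧
      ∀ v : Fin I.k, τ.real 2 v 0 = M.price I val v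

end Taxi

/-! Welfare maximization is a maximum weight matching problem: a taxicab at `u` matched with a
passenger at `v` contributes the value minus `ℓ u v`, and unmatched taxicabs stay put. Its dual
ranges over nonnegative 1-Lipschitz prices `r` (`Admissible`) and minimizes the sum of `r` over the
taxicabs plus the surpluses `max (val i - r) 0` of the passengers (`dualValue`). Lipschitz prices
bound the earthmover distance from below, so the dual value bounds the welfare of any outcome
(`socialWelfare_le_dualValue`). Given a complementary matching, every choice of served passengers
attains this bound (`Complementary.dualValue_le_socialWelfare`), and the same slackness conditions
give the equilibrium (`Complementary.isEquilibrium`).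

The surge prices are the pointwise least optimal dual prices. To find the price at `v`, add a
taxicab at `v` as the last row of the assignment problem. When the Hungarian method inserts a row,
its final potentials are tight both for the old matching and for the augmented one; hence they yield
prices minimizing both the dual value `D r` and `D r + r v`. Such prices have the least value at `v`
among all optimal ones (`IsMarginal.eq_surgePrice`). All optimal prices are complementary to one and
the same matching, and the conditions pass to the pointwise minimum (`exists_complementary`), so the
least prices are themselves optimal.

Truthfulness is a Vickrey-Clarke-Groves argument, with report `0` standing for the absence of a
passenger. The welfare gained through a passenger's report bounds what any misreport can earn, and
is itself at most the utility of the truth at the least prices (`dualValue_sub_le`).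

For the running time, the Hungarian method is written as a machine program and verified with a Hoare
calculus that counts operations. It runs once per location on a matrix whose size depends only on
the numbers of passengers and taxicabs. -/

namespace Taxi

open Finset

namespace RAM

/-! ### Total correctness of programs with a bound on the number of operations -/

/-- The arrays of natural numbers that a program may write to. -/
def Prog.natVars : Prog → List ℕ
  | .skip => []
  | .setNat a _ _ => [a]
  | .setReal _ _ _ _ => []
  | .seq c₁ c₂ => c₁.natVars ++ c₂.natVars
  | .cond _ c₁ c₂ => c₁.natVars ++ c₂.natVars
  | .loop _ c => c.natVars

/-- The arrays of real numbers that a program may write to. -/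
def Prog.realVars : Prog → List ℕ
  | .skip => []
  | .setNat _ _ _ => []
  | .setReal a _ _ _ => [a]
  | .seq c₁ c₂ => c₁.realVars ++ c₂.realVars
  | .cond _ c₁ c₂ => c₁.realVars ++ c₂.realVars
  | .loop _ c => c.realVars

/-- The memories `σ` and `τ` differ at most in the listed arrays. -/
structure Frame (ns rs : List ℕ) (σ τ : State) : Prop where
  nat : ∀ a, a ∉ ns → τ.nat a = σ.nat a
  real : ∀ a, a ∉ rs → τ.real a = σ.real a

theorem Frame.refl (ns rs : List ℕ) (σ : State) : Frame ns rs σ σ :=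
  ⟨fun _ _ => rfl, fun _ _ => rfl⟩

theorem Frame.trans {ns rs : List ℕ} {σ τ υ : State} (h₁ : Frame ns rs σ τ)
    (h₂ : Frame ns rs τ υ) : Frame ns rs σ υ :=
  ⟨fun a ha => (h₂.nat a ha).trans (h₁.nat a ha),
    fun a ha => (h₂.real a ha).trans (h₁.real a ha)⟩

theorem Frame.mono {ns rs ns' rs' : List ℕ} {σ τ : State} (h : Frame ns rs σ τ)
    (hn : ns ⊆ ns') (hr : rs ⊆ rs') : Frame ns' rs' σ τ :=
  ⟨fun a ha => h.nat a fun h' => ha (hn h'), fun a ha => h.real a fun h' => ha (hr h')⟩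

theorem State.nat_setNat (σ : State) (a i x a' i' : ℕ) :
    (σ.setNat a i x).nat a' i' = if a' = a ∧ i' = i then x else σ.nat a' i' := rfl

theorem State.real_setNat (σ : State) (a i x : ℕ) : (σ.setNat a i x).real = σ.real := rfl

theorem State.nat_setReal (σ : State) (a i j : ℕ) (x : ℝ) :
    (σ.setReal a i j x).nat = σ.nat := rfl

theorem State.real_setReal (σ : State) (a i j : ℕ) (x : ℝ) (a' i' j' : ℕ) :
    (σ.setReal a i j x).real a' i' j' = if a' = a ∧ i' = i ∧ j' = j then x else σ.real a' i' j' :=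
  rfl

theorem State.nat_setNat_of_ne (σ : State) {a a' : ℕ} (i x : ℕ) (h : a' ≠ a) :
    (σ.setNat a i x).nat a' = σ.nat a' := by
  funext j; simp [State.nat_setNat, h]

theorem State.nat_setNat_self (σ : State) (a i x : ℕ) :
    (σ.setNat a i x).nat a = Function.update (σ.nat a) i x := by
  funext j; simp [State.nat_setNat, Function.update_apply]

theorem State.real_setReal_of_ne (σ : State) {a a' : ℕ} (i j : ℕ) (x : ℝ) (h : a' ≠ a) :
    (σ.setReal a i j x).real a' = σ.real a' := by
  funext i' j'; simp [State.real_setReal, h]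

theorem Frame.setNat (σ : State) (a i x : ℕ) {ns rs : List ℕ} (h : a ∈ ns) :
    Frame ns rs σ (σ.setNat a i x) :=
  ⟨fun _ ha' => σ.nat_setNat_of_ne i x fun e => ha' (e ▸ h), fun _ _ => rfl⟩

theorem Frame.setReal (σ : State) (a i j : ℕ) (x : ℝ) {ns rs : List ℕ} (h : a ∈ rs) :
    Frame ns rs σ (σ.setReal a i j x) :=
  ⟨fun _ _ => rfl, fun _ ha' => σ.real_setReal_of_ne i j x fun e => ha' (e ▸ h)⟩

/-- A program changes only the arrays that it writes to. -/
theorem Run.frame {c : Prog} {σ τ : State} {t : ℕ} (h : Run c σ τ t) :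
    Frame c.natVars c.realVars σ τ := by
  induction h with
  | skip | loop_done => exact Frame.refl _ _ _
  | setNat => exact Frame.setNat _ _ _ _ (by simp [Prog.natVars])
  | setReal => exact Frame.setReal _ _ _ _ _ (by simp [Prog.realVars])
  | seq _ _ h₁ h₂ =>
    exact (h₁.mono (List.subset_append_left _ _) (List.subset_append_left _ _)).trans
      (h₂.mono (List.subset_append_right _ _) (List.subset_append_right _ _))
  | cond_true _ _ h => exact h.mono (List.subset_append_left _ _) (List.subset_append_left _ _)
  | cond_false _ _ h =>
    exact h.mono (List.subset_append_right _ _) (List.subset_append_right _ _)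
  | loop_step _ _ _ h₁ h₂ => exact h₁.trans h₂

/-- Started in `σ`, the program `c` halts after at most `t` operations in a memory with `Q`. -/
def Ok (c : Prog) (σ : State) (t : ℕ) (Q : State → Prop) : Prop :=
  ∃ τ t', Run c σ τ t' ∧ t' ≤ t ∧ Q τ

/-- The consequence rule also supplies the frame of the run. Specifications therefore need to
mention only what a program changes; everything else is recovered from the lists of written arrays
by `decide`. -/
theorem Ok.mono {c : Prog} {σ : State} {t t' : ℕ} {Q Q' : State → Prop} (h : Ok c σ t Q)
    (ht : t ≤ t') (hQ : ∀ τ, Frame c.natVars c.realVars σ τ → Q τ → Q' τ) : Ok c σ t' Q' := by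
  obtain ⟨τ, s, hr, hs, hq⟩ := h
  exact ⟨τ, s, hr, hs.trans ht, hQ τ hr.frame hq⟩

theorem Ok.le {c : Prog} {σ : State} {t t' : ℕ} {Q : State → Prop} (h : Ok c σ t Q)
    (ht : t ≤ t') : Ok c σ t' Q :=
  h.mono ht fun _ _ => id

theorem Ok.skip {σ : State} {Q : State → Prop} (h : Q σ) : Ok .skip σ 1 Q :=
  ⟨_, _, Run.skip σ, le_rfl, h⟩

theorem Ok.setNat {σ : State} {a : ℕ} {i e : NExp} {Q : State → Prop}
    (h : Q (σ.setNat a (i.eval σ) (e.eval σ))) :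
    Ok (.setNat a i e) σ (i.cost + e.cost + 1) Q :=
  ⟨_, _, Run.setNat σ a i e, le_rfl, h⟩

theorem Ok.setReal {σ : State} {a : ℕ} {i j : NExp} {e : RExp} {Q : State → Prop}
    (h : Q (σ.setReal a (i.eval σ) (j.eval σ) (e.eval σ))) :
    Ok (.setReal a i j e) σ (i.cost + j.cost + e.cost + 1) Q :=
  ⟨_, _, Run.setReal σ a i j e, le_rfl, h⟩

theorem Ok.seq {c₁ c₂ : Prog} {σ : State} {t₁ t₂ : ℕ} {Q : State → Prop}
    (h : Ok c₁ σ t₁ fun τ => Ok c₂ τ t₂ Q) : Ok (.seq c₁ c₂) σ (t₁ + t₂) Q := by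
  obtain ⟨τ, s, hr, hs, τ', s', hr', hs', hq⟩ := h
  exact ⟨τ', _, Run.seq hr hr', add_le_add hs hs', hq⟩

theorem Ok.cond {b : Test} {c₁ c₂ : Prog} {σ : State} {t : ℕ} {Q : State → Prop}
    (h₁ : b.Holds σ → Ok c₁ σ t Q) (h₂ : ¬ b.Holds σ → Ok c₂ σ t Q) :
    Ok (.cond b c₁ c₂) σ (b.cost + t + 1) Q := by
  by_cases hb : b.Holds σ
  · obtain ⟨τ, s, hr, hs, hq⟩ := h₁ hb
    exact ⟨τ, _, Run.cond_true hb hr, by omega, hq⟩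
  · obtain ⟨τ, s, hr, hs, hq⟩ := h₂ hb
    exact ⟨τ, _, Run.cond_false hb hr, by omega, hq⟩

/-- A loop with the invariant `Inv n`, where the variant `n` decreases in every round. -/
theorem Ok.loop {b : Test} {c : Prog} {B : ℕ} (Inv : ℕ → State → Prop)
    (hstep : ∀ n σ, Inv n σ → b.Holds σ → Ok c σ B fun τ => ∃ n' < n, Inv n' τ)
    {n : ℕ} {σ : State} (h : Inv n σ) :
    Ok (.loop b c) σ ((n + 1) * (b.cost + B + 1)) fun τ => (∃ n', Inv n' τ) ∧ ¬ b.Holds τ := by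
  induction n using Nat.strong_induction_on generalizing σ with
  | _ n ih =>
    by_cases hb : b.Holds σ
    · obtain ⟨τ, s, hr, hs, n', hn', hi⟩ := hstep n σ h hb
      obtain ⟨υ, s', hr', hs', hq⟩ := ih n' hn' hi
      refine ⟨υ, _, Run.loop_step hb hr hr', ?_, hq⟩
      have : (n' + 1) * (b.cost + B + 1) ≤ n * (b.cost + B + 1) := by gcongr; omega
      rw [add_mul]
      omega
    · refine ⟨σ, _, Run.loop_done hb, ?_, ⟨n, h⟩, hb⟩
      rw [add_mul]
      omega

/-- A loop with the invariant `Inv n`, where the variant `n` decreases in every round and the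
arrays to which the body does not write may be taken from the initial memory. -/
theorem Ok.loop_frame {b : Test} {c : Prog} {B : ℕ} {σ₀ : State} (Inv : ℕ → State → Prop)
    (hstep : ∀ n σ, Frame c.natVars c.realVars σ₀ σ → Inv n σ → b.Holds σ →
      Ok c σ B fun τ => ∃ n' < n, Inv n' τ) {n : ℕ} (h : Inv n σ₀) :
    Ok (.loop b c) σ₀ ((n + 1) * (b.cost + B + 1)) fun τ => (∃ n', Inv n' τ) ∧ ¬ b.Holds τ := by
  refine (Ok.loop (c := c) (b := b) (B := B)
    (fun n σ => Frame c.natVars c.realVars σ₀ σ ∧ Inv n σ) ?_ (n := n) (σ := σ₀)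
    ⟨Frame.refl _ _ _, h⟩).mono le_rfl ?_
  · rintro n σ ⟨hF, hI⟩ hb
    refine (hstep n σ hF hI hb).mono le_rfl ?_
    rintro τ hτ ⟨n', hn', hI'⟩
    exact ⟨n', hn', hF.trans hτ, hI'⟩
  · rintro τ - ⟨⟨n', -, hI⟩, hb⟩
    exact ⟨⟨n', hI⟩, hb⟩

/-- `for x in 0, …, N - 1 do c`, with the counter in entry `0` of the array `x`. -/
def forTo (x : ℕ) (N : NExp) (c : Prog) : Prog :=
  .seq (.setNat x (.lit 0) (.lit 0))
    (.loop (.not (.natLe N (.cell x (.lit 0))))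
      (.seq c (.setNat x (.lit 0) (.add (.cell x (.lit 0)) (.lit 1)))))

theorem Ok.forTo {x : ℕ} {N : NExp} {c : Prog} {σ₀ : State} {n B : ℕ} (Inv : ℕ → State → Prop)
    (hx : x ∉ c.natVars)
    (hN : ∀ σ, Frame (x :: c.natVars) c.realVars σ₀ σ → N.eval σ = n)
    (h0 : Inv 0 (σ₀.setNat x 0 0))
    (hstep : ∀ i < n, ∀ σ, Frame (x :: c.natVars) c.realVars σ₀ σ → σ.nat x 0 = i → Inv i σ →
      Ok c σ B fun τ => Inv (i + 1) (τ.setNat x 0 (i + 1))) :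
    Ok (RAM.forTo x N c) σ₀ ((n + 1) * (B + N.cost + 20)) fun τ => Inv n τ := by
  have key := Ok.loop (b := .not (.natLe N (.cell x (.lit 0))))
    (c := .seq c (.setNat x (.lit 0) (.add (.cell x (.lit 0)) (.lit 1)))) (B := B + 6)
    -- The variant `k` is the number of rounds left.
    (fun k σ => Frame (x :: c.natVars) c.realVars σ₀ σ ∧ ∃ i, σ.nat x 0 = i ∧ i + k = n ∧ Inv i σ)
    (by
      rintro k σ ⟨hF, i, hi, hk, hI⟩ hb
      have hin : i < n := by
        simpa [Test.Holds, NExp.eval, hN σ hF, hi] using hb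
      refine (Ok.seq (t₂ := 6) ((hstep i hin σ hF hi hI).mono le_rfl fun τ hτ hq => ?_)).le le_rfl
      refine Ok.setNat ?_
      have hxi : τ.nat x 0 = i := by rw [hτ.nat x hx, hi]
      simp only [NExp.eval, hxi]
      refine ⟨k - 1, by omega, ?_, i + 1, by simp [State.nat_setNat], by omega, hq⟩
      exact (hF.trans (hτ.mono (List.subset_cons_self _ _) (fun _ h => h))).trans
        (Frame.setNat _ _ _ _ List.mem_cons_self))
    (n := n) (σ := σ₀.setNat x 0 0)
    ⟨Frame.setNat _ _ _ _ List.mem_cons_self, 0, by simp [State.nat_setNat], by omega, h0⟩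
  refine (Ok.seq (t₁ := 3) (Ok.setNat (key.mono le_rfl ?_))).le ?_
  · rintro τ - ⟨⟨k, hF, i, hi, hk, hI⟩, hb⟩
    have : n ≤ i := by
      simpa [Test.Holds, NExp.eval, hN τ hF, hi] using hb
    obtain rfl : i = n := by omega
    exact hI
  · simp only [Test.cost, NExp.cost]
    ring_nf
    omega

end RAM

/-! ### The assignment problem: dual feasibility and complementary slackness -/

/-- `u` and `v` are dual feasible for the first `i` rows and `C` columns of the cost matrix `A`. -/
structure Feas (A : ℕ → ℕ → ℝ) (C i : ℕ) (u v : ℕ → ℝ) : Prop where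
  le : ∀ r < i, ∀ j < C, u r + v j ≤ A r j
  nonpos : ∀ j < C, v j ≤ 0

/-- The partial map `p` from columns to rows matches each of the first `i` rows, along tight edges,
and the columns that are not matched have potential `0`. -/
structure Tight (A : ℕ → ℕ → ℝ) (C i : ℕ) (p : ℕ → ℕ) (u v : ℕ → ℝ) : Prop where
  inj : ∀ j < C, ∀ j' < C, p j < i → p j = p j' → j = j'
  surj : ∀ r < i, ∃ j < C, p j = r
  tight : ∀ j < C, p j < i → u (p j) + v j = A (p j) j
  free : ∀ j < C, i ≤ p j → v j = 0

/-- The tree grown from row `i`, which is attached to the additional column `C`. The columns with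
`used j ≠ 0` are in the tree, `way j` is the predecessor of `j`, and `j₀` was added last. -/
structure Tree (A : ℕ → ℕ → ℝ) (C R i : ℕ) (p way used : ℕ → ℕ) (u v : ℕ → ℝ)
    (j₀ stamp : ℕ) : Prop where
  feas : Feas A C (i + 1) u v
  tight : Tight A C i p u v
  range : ∀ j < C, p j < i ∨ p j = R
  root : p C = i
  used_root : used C ≠ 0
  way : ∀ j < C, used j ≠ 0 → way j ≤ C ∧ used (way j) ≠ 0 ∧ used (way j) < used j ∧
    p (way j) ≤ i ∧ u (p (way j)) + v j = A (p (way j)) j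
  matched : ∀ j ≤ C, used j ≠ 0 → j ≠ j₀ → p j ≤ i
  last_le : j₀ ≤ C
  used_last : used j₀ ≠ 0
  le_stamp : ∀ j ≤ C, used j ≤ stamp

namespace Tree

variable {A : ℕ → ℕ → ℝ} {C R i : ℕ} {p way used : ℕ → ℕ} {u v : ℕ → ℝ} {j₀ stamp : ℕ}

theorem matched_lt (h : Tree A C R i p way used u v j₀ stamp) (hR : i < R) (h₀ : p j₀ ≤ i)
    {j : ℕ} (hj : j < C) (hu : used j ≠ 0) : p j < i := by
  have h1 : p j ≤ i := by
    by_cases e : j = j₀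
    · rw [e]; exact h₀
    · exact h.matched j hj.le hu e
  rcases h.range j hj with h2 | h2 <;> omega

/-- As long as the last column is matched, all tree columns below `C` are matched with distinct rows
below `i`, so they cannot exhaust more than `i` columns. -/
theorem exists_unused (h : Tree A C R i p way used u v j₀ stamp) (hR : i < R) (hC : i < C)
    (h₀ : p j₀ ≤ i) : ∃ j < C, used j = 0 := by
  by_contra! hn
  have : #(Finset.range C) ≤ #(Finset.range i) := by
    refine card_le_card_of_injOn p (fun j hj => ?_) (fun j hj j' hj' e => ?_)
    · have := h.matched_lt hR h₀ (mem_range.1 hj) (hn j (mem_range.1 hj))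
      simpa using this
    · simp only [coe_range, Set.mem_Iio] at hj hj'
      exact h.tight.inj j hj j' hj' (h.matched_lt hR h₀ hj (hn j hj)) e
  simp at this
  omega

/-- Adding a column along an edge of minimal slack, after the change of the potentials that makes
the edge tight. -/
theorem grow (h : Tree A C R i p way used u v j₀ stamp) (hR : i < R) (h₀ : p j₀ ≤ i)
    {j₁ jf : ℕ} {δ : ℝ} (hj₁ : j₁ < C) (hu₁ : used j₁ = 0) (hjf : jf ≤ C) (huf : used jf ≠ 0)
    (hδ : δ = A (p jf) j₁ - u (p jf) - v j₁)
    (hmin : ∀ j < C, used j = 0 → ∀ j' ≤ C, used j' ≠ 0 → δ ≤ A (p j') j - u (p j') - v j)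
    {u' v' : ℕ → ℝ}
    (hu : ∀ j < C, used j ≠ 0 → u' (p j) = u (p j) + δ)
    (hu_root : u' i = u i + δ)
    (hu_other : ∀ r, r ≠ i → (∀ j < C, used j ≠ 0 → p j ≠ r) → u' r = u r)
    (hv : ∀ j < C, v' j = v j - if used j ≠ 0 then δ else 0) :
    Tree A C R i p (Function.update way j₁ jf) (Function.update used j₁ (stamp + 1)) u' v' j₁
      (stamp + 1) := by
  have hm : ∀ j ≤ C, used j ≠ 0 → p j ≤ i := by
    intro j hj hju
    rcases hj.lt_or_eq with hj | rfl
    · exact (h.matched_lt hR h₀ hj hju).le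
    · exact h.root.le
  have hu' : ∀ j ≤ C, used j ≠ 0 → u' (p j) = u (p j) + δ := by
    intro j hj hju
    rcases hj.lt_or_eq with hj | rfl
    · exact hu j hj hju
    · rw [h.root]; exact hu_root
  have hun : ∀ j < C, used j = 0 → p j < i → u' (p j) = u (p j) := by
    intro j hj hju hpi
    refine hu_other _ hpi.ne fun j' hj' hju' e => ?_
    have := h.tight.inj j hj j' hj' hpi e.symm
    subst this
    exact hju' hju
  -- `δ` is the slack of an edge under feasible potentials.
  have hδ0 : 0 ≤ δ := by
    have := h.feas.le (p jf) (by have := hm jf hjf huf; omega) j₁ hj₁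
    linarith
  have hC1 : C ≠ j₁ := hj₁.ne'
  have hrow : ∀ r < i + 1, ∃ j ≤ C, p j = r := by
    intro r hr
    rcases (Nat.lt_succ_iff.1 hr).lt_or_eq with hr | rfl
    · obtain ⟨j, hj, e⟩ := h.tight.surj r hr
      exact ⟨j, hj.le, e⟩
    · exact ⟨C, le_rfl, h.root⟩
  refine ⟨⟨?_, ?_⟩, ⟨h.tight.inj, h.tight.surj, ?_, ?_⟩, h.range, h.root, ?_, ?_, ?_, hj₁.le, ?_, ?_⟩
  · intro r hr j hj
    obtain ⟨j', hj', rfl⟩ := hrow r hr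
    have hf := h.feas.le _ hr j hj
    -- Rows outside the tree keep their potential while column potentials only decrease. Rows in the
    -- tree gain `δ`, which cancels against tree columns and is at most the slack towards the
    -- others.
    by_cases hju' : used j' = 0
    · have hjC : j' < C := by
        rcases hj'.lt_or_eq with hj' | rfl
        · exact hj'
        · exact absurd hju' h.used_root
      have hpi : p j' < i := by
        rcases h.range j' hjC with e | e <;> omega
      rw [hun j' hjC hju' hpi, hv j hj]
      split_ifs <;> linarith
    · rw [hu' j' hj' hju', hv j hj]
      split_ifs with hju
      · linarith
      · have := hmin j hj (by simpa using hju) j' hj' hju'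
        linarith
  · intro j hj
    have := h.feas.nonpos j hj
    rw [hv j hj]
    split_ifs <;> linarith
  · intro j hj hpi
    have := h.tight.tight j hj hpi
    rw [hv j hj]
    split_ifs with hju
    · rw [hu j hj hju]; linarith
    · rw [hun j hj (by simpa using hju) hpi]; linarith
  · intro j hj hpi
    -- Unmatched columns are not yet in the tree, so they keep potential `0`.
    have hju : used j = 0 := by
      by_contra hju
      have := h.matched_lt hR h₀ hj hju
      omega
    rw [hv j hj, h.tight.free j hj hpi]
    simp [hju]
  · rw [Function.update_of_ne hC1]; exact h.used_root
  · intro j hj hju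
    by_cases e : j = j₁
    · subst e
      have hne : jf ≠ j := fun e => huf (e ▸ hu₁)
      simp only [Function.update_self, Function.update_of_ne hne]
      refine ⟨hjf, huf, by have := h.le_stamp jf hjf; omega, hm jf hjf huf, ?_⟩
      rw [hu' jf hjf huf, hv j hj]
      simp only [hu₁]
      simp
      linarith
    · rw [Function.update_of_ne e] at hju
      obtain ⟨h1, h2, h3, h4, h5⟩ := h.way j hj hju
      have hne : way j ≠ j₁ := fun e => h2 (e ▸ hu₁)
      rw [Function.update_of_ne e, Function.update_of_ne e, Function.update_of_ne hne]
      refine ⟨h1, h2, h3, h4, ?_⟩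
      rw [hu' _ h1 h2, hv j hj, if_pos hju]
      linarith
  · intro j hj hju e
    rw [Function.update_of_ne e] at hju
    exact hm j hj hju
  · simp
  · intro j hj
    by_cases e : j = j₁
    · subst e; simp
    · rw [Function.update_of_ne e]
      have := h.le_stamp j hj
      omega

end Tree

/-- The state of the augmentation: `p` is a matching of the rows up to `i` with the columns up to
`C`, except for the column `j₀`, and agrees with `p₀` on the tree columns before `j₀`. -/
structure Hole (A : ℕ → ℕ → ℝ) (C R i : ℕ) (p₀ p used : ℕ → ℕ) (u v : ℕ → ℝ) (j₀ : ℕ) :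
    Prop where
  agree : ∀ j ≤ C, used j < used j₀ → p j = p₀ j
  inj : ∀ j ≤ C, ∀ j' ≤ C, j ≠ j₀ → j' ≠ j₀ → p j ≤ i → p j = p j' → j = j'
  surj : ∀ r ≤ i, ∃ j ≤ C, j ≠ j₀ ∧ p j = r
  tight : ∀ j < C, j ≠ j₀ → p j ≤ i → u (p j) + v j = A (p j) j
  free : ∀ j < C, j ≠ j₀ → i < p j → v j = 0
  range : ∀ j < C, j ≠ j₀ → p j ≤ i ∨ p j = R
  hole_le : j₀ ≤ C
  used_hole : used j₀ ≠ 0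

/-- Once the last column is unmatched it serves as the hole. The new row `i` is matched with the
artificial column `C`, so all rows up to `i` are covered. -/
theorem Tree.hole {A : ℕ → ℕ → ℝ} {C R i : ℕ} {p way used : ℕ → ℕ} {u v : ℕ → ℝ} {j₀ stamp : ℕ}
    (h : Tree A C R i p way used u v j₀ stamp) (hR : i < R) (h₀ : i < p j₀) :
    Hole A C R i p p used u v j₀ := by
  have hlt : ∀ j < C, p j ≤ i → p j < i := by
    intro j hj hp
    rcases h.range j hj with e | e <;> omega
  refine ⟨fun _ _ _ => rfl, ?_, ?_, fun j hj _ hp => h.tight.tight j hj (hlt j hj hp),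
    fun j hj _ hp => h.tight.free j hj hp.le, fun j hj _ => (h.range j hj).imp_left le_of_lt,
    h.last_le, h.used_last⟩
  · intro j hj j' hj' _ _ hp e
    rcases hj.lt_or_eq with hj | rfl <;> rcases hj'.lt_or_eq with hj' | rfl
    · exact h.tight.inj j hj j' hj' (hlt j hj hp) e
    · have := hlt j hj hp
      rw [e, h.root] at this
      omega
    · rw [h.root] at e
      have := hlt j' hj' e.ge
      omega
    · rfl
  · intro r hr
    have key : ∃ j ≤ C, p j = r := by
      rcases hr.lt_or_eq with hr | rfl
      · obtain ⟨j, hj, e⟩ := h.tight.surj r hr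
        exact ⟨j, hj.le, e⟩
      · exact ⟨C, le_rfl, h.root⟩
    obtain ⟨j, hj, e⟩ := key
    refine ⟨j, hj, ?_, e⟩
    rintro rfl
    omega

/-- The hole takes over the row of its predecessor, along a tight tree edge, and the predecessor
becomes the hole. Predecessors carry smaller time stamps, so their rows are still the original ones
and the walk terminates. -/
theorem Hole.move {A : ℕ → ℕ → ℝ} {C R i : ℕ} {p₀ p way used : ℕ → ℕ} {u v : ℕ → ℝ}
    {j₀ j₁ stamp : ℕ} (ht : Tree A C R i p₀ way used u v j₁ stamp)
    (h : Hole A C R i p₀ p used u v j₀) (hne : j₀ ≠ C) :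
    Hole A C R i p₀ (Function.update p j₀ (p (way j₀))) used u v (way j₀) ∧
      used (way j₀) < used j₀ := by
  have hlt : j₀ < C := lt_of_le_of_ne h.hole_le hne
  obtain ⟨h1, h2, h3, h4, h5⟩ := ht.way j₀ hlt h.used_hole
  have hw : way j₀ ≠ j₀ := fun e => by rw [e] at h3; exact lt_irrefl _ h3
  have hp : p (way j₀) = p₀ (way j₀) := h.agree _ h1 h3
  refine ⟨⟨?_, ?_, ?_, ?_, ?_, ?_, h1, h2⟩, h3⟩
  · intro j hj hju
    have : j ≠ j₀ := by rintro rfl; omega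
    rw [Function.update_of_ne this]
    exact h.agree j hj (hju.trans h3)
  · intro j hj j' hj' hn hn' hpi e
    by_cases e1 : j = j₀ <;> by_cases e2 : j' = j₀
    · rw [e1, e2]
    · subst e1
      rw [Function.update_self, Function.update_of_ne e2] at e
      rw [Function.update_self] at hpi
      exact absurd (h.inj _ h1 j' hj' hw e2 hpi e) hn'.symm
    · subst e2
      rw [Function.update_self, Function.update_of_ne e1] at e
      rw [Function.update_of_ne e1] at hpi
      exact absurd (h.inj j hj _ h1 e1 hw hpi e) hn
    · rw [Function.update_of_ne e1, Function.update_of_ne e2] at e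
      rw [Function.update_of_ne e1] at hpi
      exact h.inj j hj j' hj' e1 e2 hpi e
  · intro r hr
    obtain ⟨j, hj, hn, e⟩ := h.surj r hr
    by_cases ej : j = way j₀
    · exact ⟨j₀, h.hole_le, hw.symm, by rw [Function.update_self, ← ej, e]⟩
    · exact ⟨j, hj, ej, by rw [Function.update_of_ne hn, e]⟩
  · intro j hj hn hpi
    by_cases e : j = j₀
    · subst e
      rw [Function.update_self, hp]
      exact h5
    · rw [Function.update_of_ne e] at hpi ⊢
      exact h.tight j hj e hpi
  · intro j hj hn hpi
    by_cases e : j = j₀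
    · subst e
      rw [Function.update_self, hp] at hpi
      omega
    · rw [Function.update_of_ne e] at hpi
      exact h.free j hj e hpi
  · intro j hj hn
    by_cases e : j = j₀
    · subst e
      rw [Function.update_self, hp]
      exact Or.inl h4
    · rw [Function.update_of_ne e]
      exact h.range j hj e

/-- When the hole is the artificial column, every row up to `i` sits in a genuine column. -/
theorem Hole.tight_succ {A : ℕ → ℕ → ℝ} {C R i : ℕ} {p₀ p used : ℕ → ℕ} {u v : ℕ → ℝ}
    (h : Hole A C R i p₀ p used u v C) :
    Tight A C (i + 1) p u v ∧ ∀ j < C, p j < i + 1 ∨ p j = R := by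
  refine ⟨⟨?_, ?_, ?_, ?_⟩, ?_⟩
  · exact fun j hj j' hj' hp e => h.inj j hj.le j' hj'.le hj.ne hj'.ne (by omega) e
  · intro r hr
    obtain ⟨j, hj, hn, e⟩ := h.surj r (by omega)
    exact ⟨j, lt_of_le_of_ne hj hn, e⟩
  · exact fun j hj hp => h.tight j hj hj.ne (by omega)
  · exact fun j hj hp => h.free j hj hj.ne (by omega)
  · exact fun j hj => (h.range j hj hj.ne).imp_left (by omega)

namespace RAM

/-! ### The Hungarian method as a program

Natural number arrays: `3` the matching, `4` the predecessors in the tree, `5` the time at which a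
column was added to the tree; counters and scalars: `6` the location, `7` the current row, `8` the
last column of the tree, `9`, `10` columns, `11`, `12` the edge of minimal slack, `13` the time,
`14` the number of columns. Real arrays: `3` the cost matrix, `4`, `5` the potentials of the
rows and the columns, `6` the minimal slack, `7` a bound for the costs. -/

/-- Entry `0` of an array of naturals. -/
abbrev var (a : ℕ) : NExp := .cell a (.lit 0)

/-- The slack of the edge from the row matched with column `10` to the column `9`. -/
def slackExp : RExp :=
  .sub (.sub (.cell 3 (.cell 3 (var 10)) (var 9)) (.cell 4 (.cell 3 (var 10)) (.lit 0)))
    (.cell 5 (var 9) (.lit 0))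

/-- Record the current edge if it leaves the tree and has a smaller slack than the recorded one. -/
def searchStep : Prog :=
  .cond (.and (.and (.natLe (.cell 5 (var 9)) (.lit 0)) (.natLe (.lit 1) (.cell 5 (var 10))))
      (.not (.and (.not (.natLe (var 14) (var 12))) (.realLe (.cell 6 (.lit 0) (.lit 0)) slackExp))))
    (.seq (.setReal 6 (.lit 0) (.lit 0) slackExp)
      (.seq (.setNat 12 (.lit 0) (var 9)) (.setNat 11 (.lit 0) (var 10))))
    .skip

/-- Find an edge of minimal slack that leaves the tree. -/
def search : Prog :=
  .seq (.setNat 12 (.lit 0) (var 14))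
    (forTo 9 (var 14) (forTo 10 (.add (var 14) (.lit 1)) searchStep))

/-- Change the potentials on the tree by the minimal slack. -/
def shift : Prog :=
  .seq
    (forTo 9 (var 14)
      (.cond (.natLe (.lit 1) (.cell 5 (var 9)))
        (.seq (.setReal 4 (.cell 3 (var 9)) (.lit 0)
            (.add (.cell 4 (.cell 3 (var 9)) (.lit 0)) (.cell 6 (.lit 0) (.lit 0))))
          (.setReal 5 (var 9) (.lit 0)
            (.sub (.cell 5 (var 9) (.lit 0)) (.cell 6 (.lit 0) (.lit 0)))))
        .skip))
    (.setReal 4 (var 7) (.lit 0) (.add (.cell 4 (var 7) (.lit 0)) (.cell 6 (.lit 0) (.lit 0))))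

/-- Add a column to the tree. -/
def growStep : Prog :=
  .seq search (.seq shift
    (.seq (.setNat 4 (var 12) (var 11))
      (.seq (.setNat 13 (.lit 0) (.add (var 13) (.lit 1)))
        (.seq (.setNat 5 (var 12) (var 13)) (.setNat 8 (.lit 0) (var 12))))))

/-- Move the hole in the matching one step towards the root of the tree. -/
def augmentStep : Prog :=
  .seq (.setNat 3 (var 8) (.cell 3 (.cell 4 (var 8)))) (.setNat 8 (.lit 0) (.cell 4 (var 8)))

/-- Start a tree at the current row. -/
def plant : Prog :=
  .seq (forTo 9 (var 14) (.setNat 5 (var 9) (.lit 0)))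
    (.seq (.setNat 5 (var 14) (.lit 1))
      (.seq (.setNat 3 (var 14) (var 7))
        (.seq (.setNat 8 (.lit 0) (var 14))
          (.seq (.setReal 4 (var 7) (.lit 0) (.sub .zero (.cell 7 (.lit 0) (.lit 0))))
            (.setNat 13 (.lit 0) (.lit 1))))))

/-- Match one more row. -/
def phase : Prog :=
  .seq plant
    (.seq (.loop (.natLe (.cell 3 (var 8)) (var 7)) growStep)
      (.loop (.not (.natLe (var 14) (var 8))) augmentStep))

/-- The pair `(j₁, jf)` has the smallest slack among the pairs in `S` with `E`; `j₁ = C` if there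
is no such pair. -/
def Best (C : ℕ) (E : ℕ → ℕ → Prop) (sl : ℕ → ℕ → ℝ) (S : ℕ → ℕ → Prop) (j₁ jf : ℕ) (δ : ℝ) :
    Prop :=
  (j₁ = C ∧ ∀ j j', S j j' → ¬ E j j') ∨
    (j₁ < C ∧ jf ≤ C ∧ E j₁ jf ∧ δ = sl j₁ jf ∧ ∀ j j', S j j' → E j j' → δ ≤ sl j j')

theorem Best.congr {C : ℕ} {E : ℕ → ℕ → Prop} {sl : ℕ → ℕ → ℝ} {S S' : ℕ → ℕ → Prop} {j₁ jf : ℕ}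
    {δ : ℝ} (h : Best C E sl S j₁ jf δ) (hS : ∀ j j', S' j j' → S j j') :
    Best C E sl S' j₁ jf δ := by
  rcases h with ⟨h1, h2⟩ | ⟨h1, h2, h3, h4, h5⟩
  · exact Or.inl ⟨h1, fun j j' h => h2 j j' (hS j j' h)⟩
  · exact Or.inr ⟨h1, h2, h3, h4, fun j j' h => h5 j j' (hS j j' h)⟩

/-- The slack of the edge from the row matched with column `j'` to the column `j`. -/
noncomputable def State.slack (σ : State) (j j' : ℕ) : ℝ :=
  σ.real 3 (σ.nat 3 j') j - σ.real 4 (σ.nat 3 j') 0 - σ.real 5 j 0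

theorem search_ok {σ : State} {C : ℕ} (hC : σ.nat 14 0 = C) :
    Ok search σ (5 + (C + 1) * ((C + 2) * 300 + 22)) fun τ =>
      Best C (fun j j' => σ.nat 5 j = 0 ∧ σ.nat 5 j' ≠ 0) σ.slack (fun j j' => j < C ∧ j' ≤ C)
        (τ.nat 12 0) (τ.nat 11 0) (τ.real 6 0 0) := by
  refine (Ok.seq (t₂ := (C + 1) * ((C + 2) * 300 + 22)) (Ok.setNat ?_)).le ?_
  · refine Ok.forTo (n := C) (B := (C + 2) * 300) (fun x τ =>
      Best C (fun j j' => σ.nat 5 j = 0 ∧ σ.nat 5 j' ≠ 0) σ.slack (fun j j' => j < x ∧ j' ≤ C)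
        (τ.nat 12 0) (τ.nat 11 0) (τ.real 6 0 0)) (by decide) ?_ ?_ ?_
    · intro τ hF
      simp only [NExp.eval]
      rw [hF.nat 14 (by decide), State.nat_setNat_of_ne _ _ _ (by decide), hC]
    -- Column index `C` signals that no edge has been recorded yet.
    · left
      simp [NExp.eval, State.nat_setNat, hC]
    · intro x hx τ hF hτx hI
      have hC' : τ.nat 14 0 = C := by
        rw [hF.nat 14 (by decide), State.nat_setNat_of_ne _ _ _ (by decide), hC]
      have h5 : τ.nat 5 = σ.nat 5 := by
        rw [hF.nat 5 (by decide), State.nat_setNat_of_ne _ _ _ (by decide)]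
      have hsl : τ.slack = σ.slack := by
        unfold State.slack
        rw [hF.nat 3 (by decide), State.nat_setNat_of_ne _ _ _ (by decide),
          hF.real 3 (by decide), hF.real 4 (by decide), hF.real 5 (by decide)]
        rfl
      refine (Ok.forTo (n := C + 1) (B := 200) (fun y υ =>
        Best C (fun j j' => σ.nat 5 j = 0 ∧ σ.nat 5 j' ≠ 0) σ.slack
          (fun j j' => (j < x ∧ j' ≤ C) ∨ (j = x ∧ j' < y))
          (υ.nat 12 0) (υ.nat 11 0) (υ.real 6 0 0)) (by decide) ?_ ?_ ?_).mono ?_ ?_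
      · intro υ hυ
        simp only [NExp.eval]
        rw [hυ.nat 14 (by decide), hC']
      · refine (hI.congr (S' := _) ?_)
        intro j j' h
        omega
      · intro y hy υ hυ hυy hJ
        have e14 : υ.nat 14 0 = C := by rw [hυ.nat 14 (by decide), hC']
        have e9 : υ.nat 9 0 = x := by rw [hυ.nat 9 (by decide), hτx]
        have e5 : υ.nat 5 = σ.nat 5 := by rw [hυ.nat 5 (by decide), h5]
        have esl : slackExp.eval υ = σ.slack x y := by
          rw [← hsl]
          simp only [slackExp, RExp.eval, NExp.eval, State.slack, e9, hυy]
          rw [hυ.nat 3 (by decide), hυ.real 3 (by decide), hυ.real 4 (by decide),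
            hυ.real 5 (by decide)]
        refine (Ok.cond (t := 100) (fun hb => ?_) (fun hb => ?_)).le (by decide)
        · refine (Ok.seq (Ok.setReal (Ok.seq (Ok.setNat (Ok.setNat ?_))))).le (by decide)
          simp only [Test.Holds, esl, NExp.eval, RExp.eval, e14, e9, e5, hυy] at hb
          obtain ⟨⟨hb1, hb2⟩, hb3⟩ := hb
          simp only [NExp.eval, State.nat_setNat, State.real_setNat, State.nat_setReal,
            State.real_setReal, esl, e9, hυy]
          norm_num
          refine Or.inr ⟨hx, by omega, ⟨by omega, by omega⟩, rfl, ?_⟩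
          intro j j' hS hE
          by_cases e : j = x ∧ j' = y
          · rw [e.1, e.2]
          have hS' : (j < x ∧ j' ≤ C) ∨ (j = x ∧ j' < y) := by omega
          rcases hJ with ⟨h1, h2⟩ | ⟨h1, h2, h3, h4, h5⟩
          · exact absurd hE (h2 j j' hS')
          · have h6 := h5 j j' hS' hE
            have : ¬ (υ.real 6 0 0 ≤ σ.slack x y) := fun hle => hb3 ⟨by omega, hle⟩
            linarith
        · refine (Ok.skip ?_).le (by decide)
          simp only [Test.Holds, esl, NExp.eval, RExp.eval, e14, e9, e5, hυy] at hb
          have c12 : (υ.setNat 10 0 (y + 1)).nat 12 0 = υ.nat 12 0 := rfl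
          have c11 : (υ.setNat 10 0 (y + 1)).nat 11 0 = υ.nat 11 0 := rfl
          have c6 : (υ.setNat 10 0 (y + 1)).real 6 0 0 = υ.real 6 0 0 := rfl
          rw [c12, c11, c6]
          rcases hJ with ⟨h1, h2⟩ | ⟨h1, h2, h3, h4, h5⟩
          · refine Or.inl ⟨h1, fun j j' hS hE => ?_⟩
            by_cases e : j = x ∧ j' = y
            · rw [e.1, e.2] at hE
              exact hb ⟨⟨by omega, by omega⟩, fun h => h.1 (by omega)⟩
            · exact h2 j j' (by omega) hE
          · refine Or.inr ⟨h1, h2, h3, h4, fun j j' hS hE => ?_⟩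
            by_cases e : j = x ∧ j' = y
            · rw [e.1, e.2] at hE ⊢
              by_contra hle
              exact hb ⟨⟨by omega, by omega⟩, fun h => hle h.2⟩
            · exact h5 j j' (by omega) hE
      · simp only [NExp.cost]; omega
      · intro υ _ hυ
        refine hυ.congr ?_
        intro j j' h
        omega
  · simp only [NExp.cost]
    omega

/-- Injectivity on the tree columns ensures that no row is shifted twice; the root row is excluded
from the loop and shifted separately. -/
theorem shift_ok {σ : State} {C i : ℕ} (hC : σ.nat 14 0 = C) (hi : σ.nat 7 0 = i)
    (hinj : ∀ j < C, ∀ j' < C, σ.nat 5 j ≠ 0 → σ.nat 5 j' ≠ 0 → σ.nat 3 j = σ.nat 3 j' → j = j')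
    (hne : ∀ j < C, σ.nat 5 j ≠ 0 → σ.nat 3 j ≠ i) :
    Ok shift σ ((C + 1) * 122 + 20) fun τ =>
      (∀ j < C, σ.nat 5 j ≠ 0 → τ.real 4 (σ.nat 3 j) 0 = σ.real 4 (σ.nat 3 j) 0 + σ.real 6 0 0) ∧
      (τ.real 4 i 0 = σ.real 4 i 0 + σ.real 6 0 0) ∧
      (∀ r, r ≠ i → (∀ j < C, σ.nat 5 j ≠ 0 → σ.nat 3 j ≠ r) → τ.real 4 r 0 = σ.real 4 r 0) ∧
      (∀ j < C, τ.real 5 j 0 = σ.real 5 j 0 - if σ.nat 5 j ≠ 0 then σ.real 6 0 0 else 0) := by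
  refine (Ok.seq (t₁ := (C + 1) * 122) (t₂ := 20) ?_).le le_rfl
  refine (Ok.forTo (n := C) (B := 100) (fun x τ =>
    (∀ j < C, σ.nat 5 j ≠ 0 → τ.real 4 (σ.nat 3 j) 0 =
      σ.real 4 (σ.nat 3 j) 0 + if j < x then σ.real 6 0 0 else 0) ∧
    (∀ r, (∀ j < C, σ.nat 5 j ≠ 0 → σ.nat 3 j ≠ r) → τ.real 4 r 0 = σ.real 4 r 0) ∧
    (∀ j < C, τ.real 5 j 0 =
      σ.real 5 j 0 - if j < x ∧ σ.nat 5 j ≠ 0 then σ.real 6 0 0 else 0))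
    (by decide) ?_ ?_ ?_).mono ?_ ?_
  · intro τ hτ
    simp only [NExp.eval]
    rw [hτ.nat 14 (by decide), hC]
  · simp [State.real_setNat]
  · intro x hx τ hτ hτx hI
    obtain ⟨h1, h2, h3⟩ := hI
    have e5 : τ.nat 5 = σ.nat 5 := hτ.nat 5 (by decide)
    have e3 : τ.nat 3 = σ.nat 3 := hτ.nat 3 (by decide)
    have e6 : τ.real 6 = σ.real 6 := hτ.real 6 (by decide)
    refine (Ok.cond (t := 50) (fun hb => ?_) (fun hb => ?_)).le (by decide)
    · have hu : σ.nat 5 x ≠ 0 := by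
        simp only [Test.Holds, NExp.eval, e5, hτx] at hb
        omega
      refine (Ok.seq (Ok.setReal (Ok.setReal ?_))).le (by decide)
      simp only [NExp.eval, RExp.eval, State.real_setNat, State.nat_setReal, State.real_setReal,
        hτx, e3, e6]
      norm_num
      refine ⟨?_, ?_, ?_⟩
      · intro j hj hju
        split_ifs with h4 h5 h5
        · have := hinj j hj x hx hju hu h4
          subst this
          rw [h1 j hj hju]
          simp
        · have := hinj j hj x hx hju hu h4
          omega
        · rw [h1 j hj hju]
          have : j ≠ x := fun e => h4 (by rw [e])
          rw [if_pos (by omega)]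
        · rw [h1 j hj hju, if_neg (by omega)]
      · intro r hr
        rw [if_neg (fun e => hr x hx hu e.symm)]
        exact h2 r hr
      · intro j hj
        by_cases e : j = x
        · subst e
          simp [h3 j hj, hu]
        · rw [if_neg e, h3 j hj]
          congr 2
          simp only [eq_iff_iff]
          refine and_congr_left fun _ => ?_
          omega
    · have hu : σ.nat 5 x = 0 := by
        simp only [Test.Holds, NExp.eval, e5, hτx] at hb
        omega
      refine (Ok.skip ?_).le (by decide)
      simp only [State.real_setNat]
      refine ⟨?_, h2, ?_⟩
      · intro j hj hju
        have : j ≠ x := fun e => hju (e ▸ hu)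
        rw [h1 j hj hju]
        congr 2
        simp only [eq_iff_iff]
        omega
      · intro j hj
        rw [h3 j hj]
        congr 2
        simp only [eq_iff_iff]
        refine and_congr_left fun h => ?_
        have : j ≠ x := fun e => h (e ▸ hu)
        omega
  · simp [NExp.cost]
  · rintro τ hτ ⟨h1, h2, h3⟩
    have e6 : τ.real 6 = σ.real 6 := hτ.real 6 (by decide)
    have e7 : τ.nat 7 = σ.nat 7 := hτ.nat 7 (by decide)
    refine (Ok.setReal ?_).le (by decide)
    simp only [NExp.eval, RExp.eval, State.real_setReal, e6, e7, hi]
    norm_num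
    refine ⟨?_, ?_, ?_, ?_⟩
    · intro j hj hju
      rw [if_neg (hne j hj hju), h1 j hj hju, if_pos hj]
    · exact h2 i hne
    · intro r hr hrn
      rw [if_neg hr]
      exact h2 r hrn
    · intro j hj
      simp [h3 j hj, hj]

/-- The tree stored in the memory. -/
def State.IsTree (σ : State) (C R i : ℕ) : Prop :=
  Tree (σ.real 3) C R i (σ.nat 3) (σ.nat 4) (σ.nat 5) (fun r => σ.real 4 r 0)
    (fun j => σ.real 5 j 0) (σ.nat 8 0) (σ.nat 13 0)

theorem growStep_ok {σ : State} {C R i : ℕ} (hC : σ.nat 14 0 = C) (hi : σ.nat 7 0 = i)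
    (hR : i < R) (hiC : i < C) (h : σ.IsTree C R i) (h₀ : σ.nat 3 (σ.nat 8 0) ≤ i) :
    Ok growStep σ ((C + 2) * ((C + 2) * 300 + 200)) fun τ =>
      τ.IsTree C R i ∧ τ.nat 13 0 = σ.nat 13 0 + 1 ∧
        ∃ j < C, σ.nat 5 j = 0 ∧ τ.nat 5 = Function.update (σ.nat 5) j (σ.nat 13 0 + 1) := by
  refine (Ok.seq (t₂ := (C + 1) * 122 + 100) ((search_ok hC).mono le_rfl ?_)).le ?_
  swap
  · ring_nf; omega
  intro τ hτ hbest
  -- The search succeeds: an unused column exists, and the root column `C` has an edge to it.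
  have hbest : τ.nat 12 0 < C ∧ τ.nat 11 0 ≤ C ∧
      (σ.nat 5 (τ.nat 12 0) = 0 ∧ σ.nat 5 (τ.nat 11 0) ≠ 0) ∧
      τ.real 6 0 0 = σ.slack (τ.nat 12 0) (τ.nat 11 0) ∧
      ∀ j j', j < C ∧ j' ≤ C → σ.nat 5 j = 0 ∧ σ.nat 5 j' ≠ 0 → τ.real 6 0 0 ≤ σ.slack j j' := by
    rcases hbest with ⟨-, h2⟩ | h2
    · obtain ⟨j, hj, hju⟩ := h.exists_unused hR hiC h₀
      exact absurd ⟨hju, h.used_root⟩ (h2 j C ⟨hj, le_rfl⟩)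
    · exact h2
  obtain ⟨hj₁, hjf, ⟨hu₁, huf⟩, hδ, hmin⟩ := hbest
  have e3 : τ.nat 3 = σ.nat 3 := hτ.nat 3 (by decide)
  have e4 : τ.nat 4 = σ.nat 4 := hτ.nat 4 (by decide)
  have e5 : τ.nat 5 = σ.nat 5 := hτ.nat 5 (by decide)
  have e13 : τ.nat 13 = σ.nat 13 := hτ.nat 13 (by decide)
  have r3 : τ.real 3 = σ.real 3 := hτ.real 3 (by decide)
  have r4 : τ.real 4 = σ.real 4 := hτ.real 4 (by decide)
  have r5 : τ.real 5 = σ.real 5 := hτ.real 5 (by decide)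
  refine (Ok.seq (t₂ := 40) ((shift_ok (C := C) (i := i) (by rw [hτ.nat 14 (by decide), hC])
    (by rw [hτ.nat 7 (by decide), hi]) ?_ ?_).mono le_rfl ?_)).le (by omega)
  · intro j hj j' hj' hju _ e
    rw [e3] at e
    rw [e5] at hju
    exact h.tight.inj j hj j' hj' (h.matched_lt hR h₀ hj hju) e
  · intro j hj hju
    rw [e5] at hju
    rw [e3]
    exact (h.matched_lt hR h₀ hj hju).ne
  rintro υ hυ ⟨g1, g2, g3, g4⟩
  rw [e3, e5, r4] at g1
  rw [e3, e5, r4] at g3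
  rw [r4] at g2
  rw [e5, r5] at g4
  have hgrow := h.grow (u' := fun r => υ.real 4 r 0) (v' := fun j => υ.real 5 j 0) hR h₀ hj₁ hu₁
    hjf huf hδ (fun j hj hju j' hj' hju' => hmin j j' ⟨hj, hj'⟩ ⟨hju, hju'⟩) g1 g2 g3 g4
  have f3 : υ.nat 3 = σ.nat 3 := by rw [hυ.nat 3 (by decide), e3]
  have f4 : υ.nat 4 = σ.nat 4 := by rw [hυ.nat 4 (by decide), e4]
  have f5 : υ.nat 5 = σ.nat 5 := by rw [hυ.nat 5 (by decide), e5]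
  have f11 : υ.nat 11 = τ.nat 11 := hυ.nat 11 (by decide)
  have f12 : υ.nat 12 = τ.nat 12 := hυ.nat 12 (by decide)
  have f13 : υ.nat 13 = σ.nat 13 := by rw [hυ.nat 13 (by decide), e13]
  have s3 : υ.real 3 = σ.real 3 := by rw [hυ.real 3 (by decide), r3]
  refine (Ok.seq (Ok.setNat (Ok.seq (Ok.setNat (Ok.seq (Ok.setNat (Ok.setNat ?_))))))).le
    (by decide)
  simp only [NExp.eval, State.IsTree, State.real_setNat, State.nat_setNat_self, ne_eq,
    Nat.reduceEqDiff, not_false_eq_true, State.nat_setNat_of_ne,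
    Function.update_self, f3, f4, f5, f11, f12, f13, s3]
  exact ⟨hgrow, trivial, τ.nat 12 0, hj₁, hu₁, rfl⟩

/-- Minus the bound is a feasible potential for the new row, because costs are at least minus the
bound and column potentials are nonpositive. Row `i` is not yet matched, so the old tight edges are
unaffected. -/
theorem plant_ok {σ : State} {C R i : ℕ} (hC : σ.nat 14 0 = C) (hi : σ.nat 7 0 = i)
    (hR : i < R) (hfeas : Feas (σ.real 3) C i (fun r => σ.real 4 r 0) (fun j => σ.real 5 j 0))
    (htight : Tight (σ.real 3) C i (σ.nat 3) (fun r => σ.real 4 r 0) (fun j => σ.real 5 j 0))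
    (hrange : ∀ j < C, σ.nat 3 j < i ∨ σ.nat 3 j = R)
    (hK : ∀ j < C, -σ.real 7 0 0 ≤ σ.real 3 i j) :
    Ok plant σ ((C + 1) * 50 + 50) fun τ => τ.IsTree C R i ∧ (∀ j < C, τ.nat 5 j = 0) ∧
      τ.nat 13 0 = 1 ∧ ∀ j < C, τ.nat 3 j = σ.nat 3 j := by
  refine (Ok.seq (t₁ := (C + 1) * 50) (t₂ := 50) ?_).le le_rfl
  refine (Ok.forTo (n := C) (B := 28) (fun x τ => ∀ j < x, τ.nat 5 j = 0)
    (by decide) ?_ ?_ ?_).mono ?_ ?_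
  · intro τ hτ
    simp only [NExp.eval]
    rw [hτ.nat 14 (by decide), hC]
  · simp
  · intro x hx τ hτ hτx hI
    refine (Ok.setNat ?_).le (by decide)
    intro j hj
    simp only [NExp.eval, State.nat_setNat, hτx]
    by_cases e : j = x
    · simp [e]
    · simpa [e] using hI j (by omega)
  · simp [NExp.cost]
  intro τ hτ hI
  have f14 : τ.nat 14 0 = C := by rw [hτ.nat 14 (by decide), hC]
  have f7 : τ.nat 7 0 = i := by rw [hτ.nat 7 (by decide), hi]
  have f3 : τ.nat 3 = σ.nat 3 := hτ.nat 3 (by decide)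
  have f4 : τ.nat 4 = σ.nat 4 := hτ.nat 4 (by decide)
  have s3 : τ.real 3 = σ.real 3 := hτ.real 3 (by decide)
  have s4 : τ.real 4 = σ.real 4 := hτ.real 4 (by decide)
  have s5 : τ.real 5 = σ.real 5 := hτ.real 5 (by decide)
  have s7 : τ.real 7 = σ.real 7 := hτ.real 7 (by decide)
  refine (Ok.seq (Ok.setNat (Ok.seq (Ok.setNat (Ok.seq (Ok.setNat (Ok.seq (Ok.setReal
    (Ok.setNat ?_))))))))).le (by decide)
  simp only [NExp.eval, RExp.eval, State.IsTree, State.real_setNat, State.nat_setReal,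
    State.nat_setNat_self, ne_eq,
    Nat.reduceEqDiff, not_false_eq_true, State.nat_setNat_of_ne,
    Function.update_self, State.real_setReal_of_ne, f3, f4, f7, f14, s3, s5, s7]
  have hu : ∀ r x, (State.setReal (((τ.setNat 5 C 1).setNat 3 C i).setNat 8 0 C) 4 i 0 x).real 4 r 0
      = if r = i then x else σ.real 4 r 0 := by
    intro r x
    simp [State.real_setReal, State.real_setNat, s4]
  have hu1 : ∀ r < i, ∀ x,
      (State.setReal (((τ.setNat 5 C 1).setNat 3 C i).setNat 8 0 C) 4 i 0 x).real 4 r 0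
      = σ.real 4 r 0 := fun r hr x => by rw [hu, if_neg hr.ne]
  have hp : ∀ j < C, Function.update (σ.nat 3) C i j = σ.nat 3 j :=
    fun j hj => Function.update_of_ne hj.ne _ _
  have h5 : ∀ j < C, Function.update (τ.nat 5) C 1 j = 0 :=
    fun j hj => by rw [Function.update_of_ne hj.ne, hI j hj]
  refine ⟨⟨⟨?_, hfeas.nonpos⟩, ⟨?_, ?_, ?_, ?_⟩, ?_, ?_, ?_, ?_, ?_, le_rfl, ?_, ?_⟩, h5, trivial,
    hp⟩
  · intro r hr j hj
    rw [hu]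
    split_ifs with e
    · have := hK j hj
      have := hfeas.nonpos j hj
      subst e
      linarith
    · exact hfeas.le r (by omega) j hj
  · intro j hj j' hj' h e
    rw [hp j hj] at h
    rw [hp j hj, hp j' hj'] at e
    exact htight.inj j hj j' hj' h e
  · intro r hr
    obtain ⟨j, hj, e⟩ := htight.surj r hr
    exact ⟨j, hj, by rw [hp j hj, e]⟩
  · intro j hj h
    rw [hp j hj] at h ⊢
    rw [hu1 _ h]
    exact htight.tight j hj h
  · intro j hj h
    rw [hp j hj] at h
    exact htight.free j hj h
  · intro j hj
    rw [hp j hj]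
    exact hrange j hj
  · simp
  · simp
  · intro j hj h
    exact absurd (h5 j hj) h
  · intro j hj h hn
    exact absurd (h5 j (lt_of_le_of_ne hj hn)) h
  · simp
  · intro j hj
    rcases hj.lt_or_eq with hj | rfl
    · simp [h5 j hj]
    · simp

/-- The variant is the number of unused columns. Its sum with the time stamp stays `C + 1`, which
bounds the stamps and thereby the length of the augmenting path. -/
theorem grow_ok {σ : State} {C R i : ℕ} (hC : σ.nat 14 0 = C) (hi : σ.nat 7 0 = i)
    (hR : i < R) (hiC : i < C) (h : σ.IsTree C R i) (h5 : ∀ j < C, σ.nat 5 j = 0)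
    (h13 : σ.nat 13 0 = 1) :
    Ok (.loop (.natLe (.cell 3 (var 8)) (var 7)) growStep) σ
      ((C + 1) * ((C + 2) * ((C + 2) * 300 + 200) + 7)) fun τ =>
      τ.IsTree C R i ∧ i < τ.nat 3 (τ.nat 8 0) ∧ τ.nat 13 0 ≤ C + 1 := by
  refine (Ok.loop_frame (n := C) (B := (C + 2) * ((C + 2) * 300 + 200)) (fun n τ => τ.IsTree C R i ∧
    n = #{j ∈ Finset.range C | τ.nat 5 j = 0} ∧ τ.nat 13 0 + n = C + 1) ?_ ?_).mono ?_ ?_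
  · rintro n τ hτ ⟨hT, hn, hs⟩ hb
    have f14 : τ.nat 14 0 = C := by rw [hτ.nat 14 (by decide), hC]
    have f7 : τ.nat 7 0 = i := by rw [hτ.nat 7 (by decide), hi]
    have h₀ : τ.nat 3 (τ.nat 8 0) ≤ i := by
      simpa [Test.Holds, NExp.eval, f7] using hb
    refine (growStep_ok f14 f7 hR hiC hT h₀).mono le_rfl ?_
    rintro υ - ⟨hT', hs', j, hj, hju, h5'⟩
    have hcard : ({j ∈ Finset.range C | υ.nat 5 j = 0} : Finset ℕ) =
        ({j ∈ Finset.range C | τ.nat 5 j = 0} : Finset ℕ).erase j := by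
      ext x
      simp only [mem_filter, Finset.mem_range, mem_erase, h5', Function.update_apply]
      split_ifs with e <;> simp [e]
    have hpos : 0 < #{j ∈ Finset.range C | τ.nat 5 j = 0} :=
      card_pos.2 ⟨j, by simp [hj, hju]⟩
    have hmem : j ∈ ({j ∈ Finset.range C | τ.nat 5 j = 0} : Finset ℕ) := by simp [hj, hju]
    refine ⟨n - 1, by omega, hT', ?_, by omega⟩
    rw [hcard, card_erase_of_mem hmem, hn]
  · refine ⟨h, ?_, by omega⟩
    rw [filter_true_of_mem (by simpa using h5), card_range]
  · simp only [Test.cost, NExp.cost]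
    exact le_of_eq (by ring)
  · rintro τ hτ ⟨⟨n, hT, -, hs⟩, hb⟩
    have f7 : τ.nat 7 0 = i := by rw [hτ.nat 7 (by decide), hi]
    refine ⟨hT, ?_, by omega⟩
    simpa [Test.Holds, NExp.eval, f7] using hb

theorem augment_ok {σ : State} {C R i : ℕ} (hC : σ.nat 14 0 = C) (hR : i < R)
    (h : σ.IsTree C R i) (h₀ : i < σ.nat 3 (σ.nat 8 0)) (hs : σ.nat 13 0 ≤ C + 1) :
    Ok (.loop (.not (.natLe (var 14) (var 8))) augmentStep) σ ((C + 2) * 50) fun τ =>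
      Tight (σ.real 3) C (i + 1) (τ.nat 3) (fun r => σ.real 4 r 0) (fun j => σ.real 5 j 0) ∧
        ∀ j < C, τ.nat 3 j < i + 1 ∨ τ.nat 3 j = R := by
  refine (Ok.loop_frame (n := σ.nat 5 (σ.nat 8 0)) (B := 30) (fun n τ =>
    Hole (σ.real 3) C R i (σ.nat 3) (τ.nat 3) (σ.nat 5) (fun r => σ.real 4 r 0)
      (fun j => σ.real 5 j 0) (τ.nat 8 0) ∧ n = σ.nat 5 (τ.nat 8 0)) ?_ ?_).mono ?_ ?_
  · rintro n τ hτ ⟨hH, hn⟩ hb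
    have f14 : τ.nat 14 0 = C := by rw [hτ.nat 14 (by decide), hC]
    have f4 : τ.nat 4 = σ.nat 4 := hτ.nat 4 (by decide)
    have hne : τ.nat 8 0 ≠ C := by
      simp only [Test.Holds, NExp.eval, f14] at hb
      omega
    obtain ⟨hH', hlt⟩ := hH.move h hne
    refine (Ok.seq (Ok.setNat (Ok.setNat ?_))).le (by decide)
    simp only [NExp.eval, State.nat_setNat_self, ne_eq,
      Nat.reduceEqDiff, not_false_eq_true, State.nat_setNat_of_ne, Function.update_self, f4]
    exact ⟨_, by rw [hn]; exact hlt, hH', rfl⟩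
  · exact ⟨h.hole hR h₀, rfl⟩
  · have := h.le_stamp _ h.last_le
    simp only [Test.cost, NExp.cost]
    have h1 : σ.nat 5 (σ.nat 8 0) ≤ C + 1 := by omega
    calc _ ≤ (C + 1 + 1) * 50 := by gcongr; omega
      _ = _ := by ring
  · rintro τ hτ ⟨⟨n, hH, -⟩, hb⟩
    have f14 : τ.nat 14 0 = C := by rw [hτ.nat 14 (by decide), hC]
    have e8 : τ.nat 8 0 = C := by
      have := hH.hole_le
      simp only [Test.Holds, NExp.eval, f14] at hb
      omega
    rw [e8] at hH
    exact hH.tight_succ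

/-- Augmentation leaves the potentials alone, and growing the tree keeps the old matching tight. The
same final potentials thus certify optimal matchings of `i` and of `i + 1` rows; the last conjunct
records the former. -/
theorem phase_ok {σ : State} {C R i : ℕ} (hC : σ.nat 14 0 = C) (hi : σ.nat 7 0 = i)
    (hR : i < R) (hiC : i < C)
    (hfeas : Feas (σ.real 3) C i (fun r => σ.real 4 r 0) (fun j => σ.real 5 j 0))
    (htight : Tight (σ.real 3) C i (σ.nat 3) (fun r => σ.real 4 r 0) (fun j => σ.real 5 j 0))
    (hrange : ∀ j < C, σ.nat 3 j < i ∨ σ.nat 3 j = R)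
    (hK : ∀ j < C, -σ.real 7 0 0 ≤ σ.real 3 i j) :
    Ok phase σ ((C + 1) * ((C + 2) * ((C + 2) * 300 + 200) + 7) + (C + 2) * 150) fun τ =>
      Feas (σ.real 3) C (i + 1) (fun r => τ.real 4 r 0) (fun j => τ.real 5 j 0) ∧
      Tight (σ.real 3) C (i + 1) (τ.nat 3) (fun r => τ.real 4 r 0) (fun j => τ.real 5 j 0) ∧
      (∀ j < C, τ.nat 3 j < i + 1 ∨ τ.nat 3 j = R) ∧
      ∃ p, Tight (σ.real 3) C i p (fun r => τ.real 4 r 0) (fun j => τ.real 5 j 0) := by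
  refine (Ok.seq (t₂ := (C + 1) * ((C + 2) * ((C + 2) * 300 + 200) + 7) + (C + 2) * 50)
    ((plant_ok hC hi hR hfeas htight hrange hK).mono le_rfl ?_)).le (by omega)
  rintro τ₁ hτ₁ ⟨hT₁, h5, h13, h3⟩
  refine (Ok.seq (t₂ := (C + 2) * 50)
    ((grow_ok (by rw [hτ₁.nat 14 (by decide), hC]) (by rw [hτ₁.nat 7 (by decide), hi]) hR hiC hT₁ h5
      h13).mono le_rfl ?_)).le le_rfl
  rintro τ₂ hτ₂ ⟨hT₂, h₀, hs⟩
  refine (augment_ok (by rw [hτ₂.nat 14 (by decide), hτ₁.nat 14 (by decide), hC]) hR hT₂ h₀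
    hs).mono le_rfl ?_
  rintro τ₃ hτ₃ ⟨hT₃, hr₃⟩
  have e4 : τ₃.real 4 = τ₂.real 4 := hτ₃.real 4 (by decide)
  have e5 : τ₃.real 5 = τ₂.real 5 := hτ₃.real 5 (by decide)
  have e3 : τ₂.real 3 = σ.real 3 := by rw [hτ₂.real 3 (by decide), hτ₁.real 3 (by decide)]
  rw [e4, e5]
  rw [e3] at hT₃
  have hf := hT₂.feas
  have ht := hT₂.tight
  rw [e3] at hf ht
  exact ⟨hf, hT₃, hr₃, _, ht⟩

end RAM

/-! ### The assignment problem of an instance -/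

/-- The location of row `r` of the assignment problem: the rows are the taxicabs and one additional
taxicab at `v`. -/
def Setting.rowLoc (I : Setting) (v : Fin I.k) (r : ℕ) : Fin I.k :=
  if h : r < I.n then I.supply ⟨r, h⟩ else v

/-- The costs of the assignment problem with an additional taxicab at `v`: the columns are the
passengers, followed by columns of cost `0`, which stand for idle taxicabs. -/
noncomputable def Setting.costMatrix (I : Setting) (val : I.Values) (v : Fin I.k) (r j : ℕ) : ℝ :=
  if h : j < I.m then I.ℓ (I.rowLoc v r) (I.profile ⟨j, h⟩) - val ⟨j, h⟩ else 0

/-- The number of columns of the assignment problem. -/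
abbrev Setting.cols (I : Setting) : ℕ := I.m + I.n + 2

/-- There are potentials that are optimal both with and without the additional taxicab at `v`, and
`x` is minus the potential of that taxicab. -/
def Setting.IsMarginal (I : Setting) (val : I.Values) (v : Fin I.k) (x : ℝ) : Prop :=
  ∃ u w p p', Feas (I.costMatrix val v) I.cols (I.n + 1) u w ∧
    Tight (I.costMatrix val v) I.cols (I.n + 1) p' u w ∧
    Tight (I.costMatrix val v) I.cols I.n p u w ∧ x = -u I.n

theorem Feas.congr {A A' : ℕ → ℕ → ℝ} {C i : ℕ} {u v : ℕ → ℝ} (h : Feas A C i u v)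
    (hA : ∀ r < i, ∀ j < C, A r j = A' r j) : Feas A' C i u v :=
  ⟨fun r hr j hj => hA r hr j hj ▸ h.le r hr j hj, h.nonpos⟩

theorem Tight.congr {A A' : ℕ → ℕ → ℝ} {C i : ℕ} {p : ℕ → ℕ} {u v : ℕ → ℝ}
    (h : Tight A C i p u v) (hA : ∀ r < i, ∀ j < C, A r j = A' r j) : Tight A' C i p u v :=
  ⟨h.inj, h.surj, fun j hj hp => hA _ hp j hj ▸ h.tight j hj hp, h.free⟩

/-! ### The program for the surge prices and its running time -/

namespace RAM

/-- The number of rows. -/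
abbrev rowsExp : NExp := .add (.cell 0 (.lit 2)) (.lit 1)

/-- Compute the cost matrix. -/
def fill : Prog :=
  forTo 7 rowsExp (forTo 9 (var 14)
    (.cond (.natLe (.cell 0 (.lit 1)) (var 9))
      (.setReal 3 (var 7) (var 9) .zero)
      (.setReal 3 (var 7) (var 9)
        (.sub (.cell 0 (.cell 2 (var 7)) (.cell 1 (var 9))) (.cell 1 (var 9) (.lit 0))))))

/-- Start with the empty matching. -/
def clear : Prog :=
  forTo 9 (var 14) (.seq (.setNat 3 (var 9) rowsExp) (.setReal 5 (var 9) (.lit 0) .zero))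

/-- Compute the price at the location `6`. -/
def priceStep : Prog :=
  .seq (.setNat 2 (.cell 0 (.lit 2)) (var 6))
    (.seq fill (.seq clear (.seq (forTo 7 rowsExp phase)
      (.setReal 2 (var 6) (.lit 0) (.sub .zero (.cell 4 (.cell 0 (.lit 2)) (.lit 0)))))))

/-- Compute a bound for the values. -/
def bound : Prog :=
  forTo 9 (.cell 0 (.lit 1)) (.setReal 7 (.lit 0) (.lit 0)
    (.add (.cell 7 (.lit 0) (.lit 0)) (.cell 1 (var 9) (.lit 0))))

/-- Compute the prices of all locations. -/
def prices : Prog :=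
  .seq (.setNat 14 (.lit 0) (.add (.add (.cell 0 (.lit 1)) (.cell 0 (.lit 2))) (.lit 2)))
    (.seq bound (forTo 6 (.cell 0 (.lit 0)) priceStep))

/-- The memory holds the setting, the values and a bound for the values. -/
structure Loaded (I : Setting) (val : I.Values) (σ : State) : Prop where
  nat0 : σ.nat 0 = (input I val).nat 0
  nat1 : σ.nat 1 = (input I val).nat 1
  supply : ∀ j : Fin I.n, σ.nat 2 j = I.supply j
  cols : σ.nat 14 0 = I.cols
  real0 : σ.real 0 = (input I val).real 0
  real1 : σ.real 1 = (input I val).real 1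
  bound_nonneg : 0 ≤ σ.real 7 0 0
  le_bound : ∀ i, val i ≤ σ.real 7 0 0

namespace Loaded

variable {I : Setting} {val : I.Values} {σ : State}

theorem m_eq (h : Loaded I val σ) : σ.nat 0 1 = I.m := by rw [h.nat0]; rfl

theorem n_eq (h : Loaded I val σ) : σ.nat 0 2 = I.n := by rw [h.nat0]; rfl

theorem k_eq (h : Loaded I val σ) : σ.nat 0 0 = I.k := by rw [h.nat0]; rfl

theorem profile_eq (h : Loaded I val σ) (i : Fin I.m) : σ.nat 1 i = I.profile i := by
  rw [h.nat1]
  simp [input]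

theorem ℓ_eq (h : Loaded I val σ) (u v : Fin I.k) : σ.real 0 u v = I.ℓ u v := by
  rw [h.real0]
  simp [input]

theorem val_eq (h : Loaded I val σ) (i : Fin I.m) : σ.real 1 i 0 = val i := by
  rw [h.real1]
  simp [input]

theorem of_frame (h : Loaded I val σ) {τ : State} {ns rs : List ℕ} (hτ : Frame ns rs σ τ)
    (h0 : 0 ∉ ns) (h1 : 1 ∉ ns) (h2 : 2 ∉ ns) (h14 : 14 ∉ ns) (r0 : 0 ∉ rs) (r1 : 1 ∉ rs)
    (r7 : 7 ∉ rs) : Loaded I val τ :=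
  ⟨(hτ.nat 0 h0).trans h.nat0, (hτ.nat 1 h1).trans h.nat1,
    fun j => by rw [hτ.nat 2 h2]; exact h.supply j, by rw [hτ.nat 14 h14]; exact h.cols,
    (hτ.real 0 r0).trans h.real0, (hτ.real 1 r1).trans h.real1,
    by rw [hτ.real 7 r7]; exact h.bound_nonneg, by rw [hτ.real 7 r7]; exact h.le_bound⟩

end Loaded

theorem fill_ok {I : Setting} {val : I.Values} {σ : State} (h : Loaded I val σ) {v : Fin I.k}
    (hv : σ.nat 2 I.n = v) :
    Ok fill σ ((I.n + 2) * ((I.cols + 1) * 72 + 24)) fun τ =>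
      ∀ r < I.n + 1, ∀ j < I.cols, τ.real 3 r j = I.costMatrix val v r j := by
  refine (Ok.forTo (n := I.n + 1) (B := (I.cols + 1) * 72)
    (fun x τ => ∀ r < x, ∀ j < I.cols, τ.real 3 r j = I.costMatrix val v r j) (by decide)
    ?_ ?_ ?_).le ?_
  · intro τ hτ
    simp only [NExp.eval]
    rw [hτ.nat 0 (by decide), h.n_eq]
  · simp
  · intro x hx τ hτ hτx hI
    have hL := h.of_frame hτ (by decide) (by decide) (by decide) (by decide) (by decide) (by decide)
      (by decide)
    have hv' : τ.nat 2 I.n = v := by rw [hτ.nat 2 (by decide), hv]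
    refine (Ok.forTo (n := I.cols) (B := 50)
      (fun y υ => (∀ r < x, ∀ j < I.cols, υ.real 3 r j = I.costMatrix val v r j) ∧
        ∀ j < y, υ.real 3 x j = I.costMatrix val v x j) (by decide) ?_ ?_ ?_).mono ?_ ?_
    · intro υ hυ
      simp only [NExp.eval]
      rw [hυ.nat 14 (by decide), hL.cols]
    · exact ⟨hI, by simp⟩
    · rintro y hy υ hυ hυy ⟨h1, h2⟩
      have hL' := hL.of_frame hυ (by decide) (by decide) (by decide) (by decide) (by decide)
        (by decide) (by decide)
      have hυx : υ.nat 7 0 = x := by rw [hυ.nat 7 (by decide), hτx]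
      have key : ∀ a, a = I.costMatrix val v x y →
          (∀ r < x, ∀ j < I.cols,
            (State.setReal υ 3 x y a).real 3 r j = I.costMatrix val v r j) ∧
          ∀ j < y + 1, (State.setReal υ 3 x y a).real 3 x j = I.costMatrix val v x j := by
        rintro a rfl
        refine ⟨fun r hr j hj => ?_, fun j hj => ?_⟩
        · rw [State.real_setReal, if_neg (by omega)]
          exact h1 r hr j hj
        · rw [State.real_setReal]
          split_ifs with e
          · rw [e.2.2]
          · exact h2 j (by omega)
      refine (Ok.cond (t := 30) (fun hb => ?_) (fun hb => ?_)).le (by decide)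
      · refine (Ok.setReal ?_).le (by decide)
        simp only [Test.Holds, NExp.eval, hL'.m_eq, hυy] at hb
        simp only [State.real_setNat, NExp.eval, RExp.eval, hυx, hυy]
        exact key _ (by rw [Setting.costMatrix, dif_neg (by omega)])
      · refine (Ok.setReal ?_).le (by decide)
        simp only [Test.Holds, NExp.eval, hL'.m_eq, hυy] at hb
        simp only [State.real_setNat, NExp.eval, RExp.eval, hυx, hυy]
        refine key _ ?_
        rw [Setting.costMatrix, dif_pos (by omega)]
        have hsup : υ.nat 2 x = I.rowLoc v x := by
          unfold Setting.rowLoc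
          split_ifs with hxn
          · exact hL'.supply ⟨x, hxn⟩
          · obtain rfl : x = I.n := by omega
            rw [hυ.nat 2 (by decide), hv']
        have hp := hL'.profile_eq ⟨y, by omega⟩
        have hval := hL'.val_eq ⟨y, by omega⟩
        simp only at hp hval
        rw [hsup, hp, hval, hL'.ℓ_eq]
    · simp [NExp.cost]
    · rintro υ - ⟨h1, h2⟩ r hr j hj
      simp only [State.real_setNat]
      rcases (Nat.lt_succ_iff.1 hr).lt_or_eq with hr | rfl
      · exact h1 r hr j hj
      · exact h2 j hj
  · simp only [NExp.cost]
    exact le_of_eq (by ring)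

theorem clear_ok {I : Setting} {val : I.Values} {σ : State} (h : Loaded I val σ) :
    Ok clear σ ((I.cols + 1) * 72) fun τ =>
      ∀ j < I.cols, τ.nat 3 j = I.n + 1 ∧ τ.real 5 j 0 = 0 := by
  refine (Ok.forTo (n := I.cols) (B := 50)
    (fun x τ => ∀ j < x, τ.nat 3 j = I.n + 1 ∧ τ.real 5 j 0 = 0) (by decide) ?_ ?_ ?_).le ?_
  · intro τ hτ
    simp only [NExp.eval]
    rw [hτ.nat 14 (by decide), h.cols]
  · simp
  · intro x hx τ hτ hτx hI
    refine (Ok.seq (Ok.setNat (Ok.setReal ?_))).le (by decide)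
    have hn : τ.nat 0 2 = I.n := by rw [hτ.nat 0 (by decide), h.n_eq]
    simp only [State.real_setNat, State.nat_setReal, State.nat_setNat, State.real_setReal, NExp.eval,
      RExp.eval, hτx, hn]
    norm_num
    intro j hj
    by_cases e : j = x
    · simp [e]
    · simpa [e] using hI j (by omega)
  · simp [NExp.cost]

/-- A bound for the number of operations of a phase, in terms of the number of columns. -/
def phaseCost (C : ℕ) : ℕ :=
  (C + 1) * ((C + 2) * ((C + 2) * 300 + 200) + 7) + (C + 2) * 150

theorem phases_ok {I : Setting} {val : I.Values} {σ : State} (h : Loaded I val σ) {v : Fin I.k}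
    (hA : ∀ r < I.n + 1, ∀ j < I.cols, σ.real 3 r j = I.costMatrix val v r j)
    (hp : ∀ j < I.cols, σ.nat 3 j = I.n + 1 ∧ σ.real 5 j 0 = 0) :
    Ok (forTo 7 rowsExp phase) σ ((I.n + 2) * (phaseCost I.cols + 24)) fun τ =>
      I.IsMarginal val v (-τ.real 4 I.n 0) := by
  refine (Ok.forTo (n := I.n + 1) (B := phaseCost I.cols)
    (fun x τ =>
      Feas (σ.real 3) I.cols x (fun r => τ.real 4 r 0) (fun j => τ.real 5 j 0) ∧
      Tight (σ.real 3) I.cols x (τ.nat 3) (fun r => τ.real 4 r 0) (fun j => τ.real 5 j 0) ∧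
      (∀ j < I.cols, τ.nat 3 j < x ∨ τ.nat 3 j = I.n + 1) ∧
      -- The matching before the latest phase; for the last row this is the one without the
      -- additional taxicab.
      ∀ x', x = x' + 1 →
        ∃ p, Tight (σ.real 3) I.cols x' p (fun r => τ.real 4 r 0) (fun j => τ.real 5 j 0))
    (by decide) ?_ ?_ ?_).mono ?_ ?_
  · intro τ hτ
    simp only [NExp.eval]
    rw [hτ.nat 0 (by decide), h.n_eq]
  -- With no rows, nothing is required of the row potentials, so old contents of that array are
  -- harmless.
  · refine ⟨⟨by simp, fun j hj => (hp j hj).2.le⟩, ⟨by simp, by simp, by simp, ?_⟩, ?_, by simp⟩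
    · exact fun j hj _ => (hp j hj).2
    · exact fun j hj => Or.inr (hp j hj).1
  · rintro x hx τ hτ hτx ⟨h1, h2, h3, -⟩
    have hL := h.of_frame hτ (by decide) (by decide) (by decide) (by decide) (by decide) (by decide)
      (by decide)
    have e3 : τ.real 3 = σ.real 3 := hτ.real 3 (by decide)
    refine (phase_ok (C := I.cols) (R := I.n + 1) (i := x) hL.cols hτx hx
      (by simp only [Setting.cols]; omega) (e3 ▸ h1)
      (e3 ▸ h2) h3 ?_).mono le_rfl ?_
    · intro j hj
      rw [e3, hA x hx j hj, Setting.costMatrix]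
      split_ifs with hjm
      · have := hL.le_bound ⟨j, hjm⟩
        have := I.ℓ_nonneg (I.rowLoc v x) (I.profile ⟨j, hjm⟩)
        linarith
      · have := hL.bound_nonneg
        linarith
    · rintro υ - ⟨g1, g2, g3, g4⟩
      rw [e3] at g1 g2 g4
      refine ⟨g1, g2, g3, ?_⟩
      rintro x' e
      obtain rfl : x = x' := by omega
      exact g4
  · simp only [NExp.cost]
    exact le_of_eq (by ring)
  · rintro τ - ⟨h1, h2, -, h4⟩
    obtain ⟨p, h4⟩ := h4 I.n rfl
    exact ⟨_, _, p, _, h1.congr hA, h2.congr hA, h4.congr fun r hr => hA r (by omega), rfl⟩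

/-- A bound for the number of operations per location, in terms of the number of columns. -/
def priceCost (C : ℕ) : ℕ :=
  30 + C * ((C + 1) * 72 + 24) + (C + 1) * 72 + C * (phaseCost C + 24)

theorem priceStep_ok {I : Setting} {val : I.Values} {σ : State} (h : Loaded I val σ) {v : Fin I.k}
    (hv : σ.nat 6 0 = v) :
    Ok priceStep σ (priceCost I.cols) fun τ => Loaded I val τ ∧ I.IsMarginal val v (τ.real 2 v 0) ∧
      ∀ w, w ≠ v → τ.real 2 w 0 = σ.real 2 w 0 := by
  have hn : I.n + 2 ≤ I.cols := by simp only [Setting.cols]; omega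
  have hle : 10 + ((I.n + 2) * ((I.cols + 1) * 72 + 24) + ((I.cols + 1) * 72 +
      ((I.n + 2) * (phaseCost I.cols + 24) + 20))) ≤ priceCost I.cols := by
    have h1 := Nat.mul_le_mul_right ((I.cols + 1) * 72 + 24) hn
    have h2 := Nat.mul_le_mul_right (phaseCost I.cols + 24) hn
    unfold priceCost
    omega
  refine (Ok.seq (t₁ := 10) ((Ok.setNat (Q := fun τ => τ = σ.setNat 2 I.n v) ?_).mono (by decide)
    ?_)).le hle
  · simp only [NExp.eval, h.n_eq, hv]
  rintro _ - rfl
  -- `Loaded` constrains only the entries below `n` of the supply array, so entry `n` can hold the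
  -- additional taxicab and be reused for every location.
  have hL : Loaded I val (σ.setNat 2 I.n v) := by
    refine ⟨h.nat0, h.nat1, fun j => ?_, h.cols, h.real0, h.real1, h.bound_nonneg, h.le_bound⟩
    rw [State.nat_setNat, if_neg (by have := j.2; omega)]
    exact h.supply j
  refine Ok.seq ((fill_ok hL (v := v) (by simp [State.nat_setNat])).mono le_rfl fun τ₁ hτ₁ hA => ?_)
  have hL₁ := hL.of_frame hτ₁ (by decide) (by decide) (by decide) (by decide) (by decide)
    (by decide) (by decide)
  refine Ok.seq ((clear_ok hL₁).mono le_rfl fun τ₂ hτ₂ hp => ?_)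
  have hL₂ := hL₁.of_frame hτ₂ (by decide) (by decide) (by decide) (by decide) (by decide)
    (by decide) (by decide)
  have e3 : τ₂.real 3 = τ₁.real 3 := hτ₂.real 3 (by decide)
  refine Ok.seq ((phases_ok hL₂ (v := v) (by rw [e3]; exact hA) hp).mono le_rfl
    fun τ₃ hτ₃ hM => ?_)
  have hL₃ := hL₂.of_frame hτ₃ (by decide) (by decide) (by decide) (by decide) (by decide)
    (by decide) (by decide)
  have e6 : τ₃.nat 6 0 = v := by
    rw [hτ₃.nat 6 (by decide), hτ₂.nat 6 (by decide), hτ₁.nat 6 (by decide)]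
    exact hv
  have e2 : τ₃.real 2 = σ.real 2 := by
    rw [hτ₃.real 2 (by decide), hτ₂.real 2 (by decide), hτ₁.real 2 (by decide)]
    rfl
  refine (Ok.setReal ?_).le (by decide)
  simp only [NExp.eval, RExp.eval, hL₃.n_eq, e6, zero_sub]
  refine ⟨hL₃.of_frame (Frame.setReal (ns := []) (rs := [2]) _ _ _ _ _ (by decide)) (by decide)
    (by decide) (by decide) (by decide) (by decide) (by decide) (by decide), ?_, ?_⟩
  · simpa [State.real_setReal] using hM
  · intro w hw
    rw [State.real_setReal, if_neg (by simpa [Fin.ext_iff] using hw), e2]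

/-- The bound is the sum of all values, which dominates each of them since they are nonnegative. -/
theorem bound_ok {I : Setting} {val : I.Values} (hval : ∀ i, 0 ≤ val i) {σ : State}
    (h0 : σ.nat 0 = (input I val).nat 0) (h1 : σ.nat 1 = (input I val).nat 1)
    (h2 : σ.nat 2 = (input I val).nat 2) (h14 : σ.nat 14 0 = I.cols)
    (hr : σ.real = (input I val).real) :
    Ok bound σ ((I.m + 1) * 50) (Loaded I val) := by
  have hm : σ.nat 0 1 = I.m := by rw [h0]; rfl
  have h7 : σ.real 7 0 0 = 0 := by rw [hr]; rfl
  refine (Ok.forTo (n := I.m) (B := 27) (fun x τ => 0 ≤ τ.real 7 0 0 ∧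
    ∀ i : Fin I.m, (i : ℕ) < x → val i ≤ τ.real 7 0 0) (by decide) ?_ ?_ ?_).mono ?_ ?_
  · intro τ hτ
    simp only [NExp.eval]
    rw [hτ.nat 0 (by decide), hm]
  · exact ⟨h7.ge, by simp⟩
  · rintro x hx τ hτ hτx ⟨g1, g2⟩
    have e1 : τ.real 1 x 0 = val ⟨x, hx⟩ := by
      rw [hτ.real 1 (by decide), hr]
      simp [input, hx]
    refine (Ok.setReal ?_).le (by decide)
    simp only [State.real_setNat, NExp.eval, RExp.eval, State.real_setReal, hτx, e1, and_self,
      if_true]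
    have := hval ⟨x, hx⟩
    refine ⟨by linarith, fun i hi => ?_⟩
    rcases (Nat.lt_succ_iff.1 hi).lt_or_eq with hi | hi
    · have := g2 i hi
      linarith
    · have : i = ⟨x, hx⟩ := Fin.ext hi
      rw [this]
      linarith
  · simp [NExp.cost]
  · rintro τ hτ ⟨g1, g2⟩
    refine ⟨by rw [hτ.nat 0 (by decide), h0], by rw [hτ.nat 1 (by decide), h1], fun j => ?_, ?_,
      by rw [hτ.real 0 (by decide), hr], by rw [hτ.real 1 (by decide), hr], g1,
      fun i => g2 i i.2⟩
    · rw [hτ.nat 2 (by decide), h2]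
      simp [input]
    · rw [hτ.nat 14 (by decide), h14]

theorem prices_ok (I : Setting) (val : I.Values) (hval : ∀ i, 0 ≤ val i) :
    Ok prices (input I val) (15 + ((I.m + 1) * 50 + (I.k + 1) * (priceCost I.cols + 22))) fun τ =>
      ∀ v : Fin I.k, I.IsMarginal val v (τ.real 2 v 0) := by
  refine (Ok.seq (t₁ := 15) ((Ok.setNat (Q := fun τ => τ = (input I val).setNat 14 0 I.cols)
    rfl).mono (by decide) ?_))
  rintro _ - rfl
  refine Ok.seq ((bound_ok hval (σ := (input I val).setNat 14 0 I.cols) rfl rfl rfl rfl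
    rfl).mono le_rfl fun τ₁ _ hL => ?_)
  refine (Ok.forTo (n := I.k) (B := priceCost I.cols) (fun x τ => Loaded I val τ ∧
    ∀ v : Fin I.k, (v : ℕ) < x → I.IsMarginal val v (τ.real 2 v 0)) (by decide) ?_ ?_ ?_).mono ?_ ?_
  · intro τ hτ
    simp only [NExp.eval]
    rw [hτ.nat 0 (by decide), hL.k_eq]
  · refine ⟨hL.of_frame (Frame.setNat (ns := [6]) (rs := []) _ _ _ _ (by decide)) (by decide)
      (by decide) (by decide) (by decide) (by decide) (by decide) (by decide), by simp⟩
  · rintro x hx τ hτ hτx ⟨hLτ, g⟩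
    refine (priceStep_ok hLτ (v := ⟨x, hx⟩) hτx).mono le_rfl ?_
    rintro υ - ⟨hLυ, hM, ho⟩
    refine ⟨hLυ.of_frame (Frame.setNat (ns := [6]) (rs := []) _ _ _ _ (by decide)) (by decide)
      (by decide) (by decide) (by decide) (by decide) (by decide) (by decide), fun v hv => ?_⟩
    simp only [State.real_setNat]
    by_cases e : v = ⟨x, hx⟩
    · rw [e]; exact hM
    · have hne : (v : ℕ) ≠ x := fun h => e (Fin.ext h)
      rw [ho v e]
      exact g v (by omega)
  · simp only [NExp.cost]
    exact le_of_eq (by ring)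
  · rintro τ - ⟨-, g⟩ v
    exact g v v.2

/-- The polynomial that bounds the number of operations per location. -/
noncomputable def pricePoly : Polynomial ℕ :=
  let C : Polynomial ℕ := .X + 2
  15 + ((.X + 1) * 50 + (30 + C * ((C + 1) * 72 + 24) + (C + 1) * 72 +
    C * ((C + 1) * ((C + 2) * ((C + 2) * 300 + 200) + 7) + (C + 2) * 150 + 24) + 22))

/-- The work per location depends only on `m + n + 2`, the number of columns; the factor `k + 1`
also absorbs the initialization. -/
theorem le_pricePoly (k m n : ℕ) :
    15 + ((m + 1) * 50 + (k + 1) * (priceCost (m + n + 2) + 22)) ≤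
      (k + 1) * pricePoly.eval (m + n) := by
  have : pricePoly.eval (m + n) =
      15 + ((m + n + 1) * 50 + (priceCost (m + n + 2) + 22)) := by
    simp [pricePoly, priceCost, phaseCost]
  rw [this, mul_add (k + 1) 15, mul_add (k + 1) ((m + n + 1) * 50)]
  have h1 : 1 * 15 ≤ (k + 1) * 15 := Nat.mul_le_mul_right _ (by omega)
  have h2 : 1 * ((m + n + 1) * 50) ≤ (k + 1) * ((m + n + 1) * 50) :=
    Nat.mul_le_mul_right _ (by omega)
  omega

end RAM

namespace Setting

variable {I : Setting}

/-! ### Duality between matchings and prices -/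

/-- Nonnegative prices that are `1`-Lipschitz: these are the feasible solutions of the dual of the
welfare maximization problem. -/
structure Admissible (r : I.Prices) : Prop where
  nonneg : ∀ v, 0 ≤ r v
  lipschitz : ∀ u v, r v - I.ℓ u v ≤ r u

/-- `f` assigns passengers to some of the taxicabs, no passenger twice. -/
def IsMatching {N : ℕ} (f : Fin N → Option (Fin I.m)) : Prop :=
  ∀ j j' i, f j = some i → f j' = some i → j = j'

/-- The weight of a matching of taxicabs at the locations `g`. -/
noncomputable def weight {N : ℕ} (g : Fin N → Fin I.k) (val : I.Values)
    (f : Fin N → Option (Fin I.m)) : ℝ :=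
  ∑ j, (f j).elim 0 fun i => val i - I.ℓ (g j) (I.profile i)

/-- The objective of the dual problem for taxicabs at the locations `g`. -/
noncomputable def dualValue {N : ℕ} (g : Fin N → Fin I.k) (val : I.Values) (r : I.Prices) : ℝ :=
  ∑ j, r (g j) + ∑ i, max (val i - r (I.profile i)) 0

theorem sum_eq_sum_matched_add {N : ℕ} {f : Fin N → Option (Fin I.m)} (hf : IsMatching f)
    (q : Fin I.m → ℝ) :
    ∑ i, q i = ∑ j, (f j).elim 0 q + ∑ i with ∀ j, f j ≠ some i, q i := by
  have h1 : ∀ j, (f j).elim 0 q = ∑ i, if f j = some i then q i else 0 := by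
    intro j
    cases h : f j with
    | none => simp
    | some i => simp [Option.some.injEq]
  have h2 : ∀ i, (∑ j, if f j = some i then q i else 0) =
      if ∀ j, f j ≠ some i then 0 else q i := by
    intro i
    split_ifs with h
    · exact sum_eq_zero fun j _ => if_neg (h j)
    · push Not at h
      obtain ⟨j, hj⟩ := h
      rw [sum_eq_single j (fun j' _ hn => if_neg fun e => hn (hf j' j i e hj)) (by simp), if_pos hj]
  rw [sum_congr rfl fun j _ => h1 j, sum_comm, sum_congr rfl fun i _ => h2 i, sum_filter,
    ← sum_add_distrib]
  refine sum_congr rfl fun i _ => ?_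
  split_ifs <;> simp

/-- The slack of taxicab `j` in the complementary slackness conditions. -/
noncomputable def taxiSlack {N : ℕ} (g : Fin N → Fin I.k) (val : I.Values) (r : I.Prices)
    (f : Fin N → Option (Fin I.m)) (j : Fin N) : ℝ :=
  (f j).elim (r (g j)) fun i =>
    r (g j) + max (val i - r (I.profile i)) 0 - (val i - I.ℓ (g j) (I.profile i))

theorem taxiSlack_nonneg {N : ℕ} (g : Fin N → Fin I.k) (val : I.Values) {r : I.Prices}
    (hr : Admissible r) (f : Fin N → Option (Fin I.m)) (j : Fin N) : 0 ≤ taxiSlack g val r f j := by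
  unfold taxiSlack
  cases f j with
  | none => exact hr.nonneg _
  | some i =>
    have h1 := hr.lipschitz (g j) (I.profile i)
    have h2 := le_max_left (val i - r (I.profile i)) 0
    simp only [Option.elim]
    linarith

/-- The duality gap in explicit form. For admissible prices all its terms are nonnegative, which
yields both weak duality and complementary slackness. -/
theorem dualValue_eq {N : ℕ} (g : Fin N → Fin I.k) (val : I.Values) (r : I.Prices)
    {f : Fin N → Option (Fin I.m)} (hf : IsMatching f) :
    dualValue g val r = weight g val f + (∑ j, taxiSlack g val r f j +
      ∑ i with ∀ j, f j ≠ some i, max (val i - r (I.profile i)) 0) := by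
  unfold dualValue weight
  rw [sum_eq_sum_matched_add hf, ← add_assoc, ← add_assoc, ← sum_add_distrib, ← sum_add_distrib]
  congr 1
  refine sum_congr rfl fun j _ => ?_
  unfold taxiSlack
  cases f j with
  | none => simp
  | some i => simp only [Option.elim]; ring

theorem weight_le_dualValue {N : ℕ} (g : Fin N → Fin I.k) (val : I.Values) {r : I.Prices}
    (hr : Admissible r) {f : Fin N → Option (Fin I.m)} (hf : IsMatching f) :
    weight g val f ≤ dualValue g val r := by
  rw [dualValue_eq g val r hf]
  have h1 : 0 ≤ ∑ j, taxiSlack g val r f j := sum_nonneg fun j _ => taxiSlack_nonneg g val hr f j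
  have h2 : 0 ≤ ∑ i with ∀ j, f j ≠ some i, max (val i - r (I.profile i)) 0 :=
    sum_nonneg fun i _ => le_max_right _ _
  linarith

/-- Complementary slackness of the prices `r` and the matching `f`. -/
structure Complementary (val : I.Values) (r : I.Prices) (f : Fin I.n → Option (Fin I.m)) :
    Prop where
  idle : ∀ j, f j = none → r (I.supply j) = 0
  moves : ∀ j i, f j = some i → r (I.supply j) = r (I.profile i) - I.ℓ (I.supply j) (I.profile i)
  matched : ∀ j i, f j = some i → r (I.profile i) ≤ val i
  unmatched : ∀ i, (∀ j, f j ≠ some i) → val i ≤ r (I.profile i)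

theorem complementary_iff {val : I.Values} {r : I.Prices} (hr : Admissible r)
    {f : Fin I.n → Option (Fin I.m)} (hf : IsMatching f) :
    Complementary val r f ↔ dualValue I.supply val r = weight I.supply val f := by
  have h1 : 0 ≤ ∑ j, taxiSlack I.supply val r f j :=
    sum_nonneg fun j _ => taxiSlack_nonneg I.supply val hr f j
  have h2 : 0 ≤ ∑ i with ∀ j, f j ≠ some i, max (val i - r (I.profile i)) 0 :=
    sum_nonneg fun i _ => le_max_right _ _
  have h3 : dualValue I.supply val r = weight I.supply val f ↔
      (∀ j, taxiSlack I.supply val r f j = 0) ∧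
        ∀ i, (∀ j, f j ≠ some i) → max (val i - r (I.profile i)) 0 = 0 := by
    rw [dualValue_eq I.supply val r hf]
    constructor
    · intro h
      have e1 : ∑ j, taxiSlack I.supply val r f j = 0 := by linarith
      have e2 : ∑ i with ∀ j, f j ≠ some i, max (val i - r (I.profile i)) 0 = 0 := by linarith
      rw [sum_eq_zero_iff_of_nonneg fun j _ => taxiSlack_nonneg I.supply val hr f j] at e1
      rw [sum_eq_zero_iff_of_nonneg fun i _ => le_max_right _ _] at e2
      exact ⟨fun j => e1 j (mem_univ j), fun i hi => e2 i (by simpa using hi)⟩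
    · rintro ⟨e1, e2⟩
      rw [sum_eq_zero fun j _ => e1 j, sum_eq_zero fun i hi => e2 i (by simpa using hi)]
      simp
  rw [h3]
  constructor
  · rintro ⟨a, b, c, d⟩
    refine ⟨fun j => ?_, fun i hi => max_eq_right (by linarith [d i hi])⟩
    unfold taxiSlack
    cases h : f j with
    | none => exact a j h
    | some i =>
      simp only [Option.elim]
      rw [b j i h, max_eq_left (by linarith [c j i h])]
      ring
  · rintro ⟨a, b⟩
    have key : ∀ j i, f j = some i →
        r (I.supply j) + max (val i - r (I.profile i)) 0 -
          (val i - I.ℓ (I.supply j) (I.profile i)) = 0 := by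
      intro j i h
      have := a j
      simpa [taxiSlack, h] using this
    refine ⟨fun j h => ?_, fun j i h => ?_, fun j i h => ?_, fun i hi => ?_⟩
    · have := a j
      simpa [taxiSlack, h] using this
    · have h1 := key j i h
      have h2 := le_max_left (val i - r (I.profile i)) 0
      have h3 := hr.lipschitz (I.supply j) (I.profile i)
      linarith
    · have h1 := key j i h
      have h2 := le_max_right (val i - r (I.profile i)) 0
      have h3 := hr.lipschitz (I.supply j) (I.profile i)
      linarith
    · have h1 := b i hi
      have h2 := le_max_left (val i - r (I.profile i)) 0
      linarith

/-- Optimal potentials of the assignment problem come with a matching of at least the dual value. -/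
theorem exists_matching_of_tight {N : ℕ} {g : Fin N → Fin I.k} {val : I.Values}
    {A : ℕ → ℕ → ℝ} {C : ℕ} {p : ℕ → ℕ} {u w : ℕ → ℝ}
    (hA : ∀ (j : Fin N) (c : ℕ), A j c =
      if h : c < I.m then I.ℓ (g j) (I.profile ⟨c, h⟩) - val ⟨c, h⟩ else 0)
    (hC : I.m ≤ C) (hw : ∀ c < C, w c ≤ 0) (ht : Tight A C N p u w) :
    ∃ f : Fin N → Option (Fin I.m), IsMatching f ∧
      ∑ j : Fin N, -u j + ∑ i : Fin I.m, -w i ≤ weight g val f := by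
  choose col hcol hp using fun j : Fin N => ht.surj j j.2
  let f : Fin N → Option (Fin I.m) := fun j => if h : col j < I.m then some ⟨col j, h⟩ else none
  have hf : ∀ j i, f j = some i → col j = i := by
    intro j i h
    simp only [f] at h
    split_ifs at h with hc
    exact congrArg Fin.val (Option.some.inj h)
  have hM : IsMatching f := by
    intro j j' i h h'
    apply Fin.ext
    rw [← hp j, ← hp j', hf j i h, hf j' i h']
  refine ⟨f, hM, ?_⟩
  -- The column of an unmatched passenger is free, hence has potential `0`.
  have hz : ∑ i with ∀ j, f j ≠ some i, -w (i : Fin I.m) = 0 := by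
    refine sum_eq_zero fun i hi => ?_
    simp only [mem_filter, mem_univ, true_and] at hi
    rw [ht.free i (i.2.trans_le hC), neg_zero]
    by_contra! hlt
    have hi' := hi ⟨p i, hlt⟩
    have e : col ⟨p i, hlt⟩ = i := by
      have h1 := hp ⟨p i, hlt⟩
      exact ht.inj _ (hcol _) i (i.2.trans_le hC) (by rw [h1]; exact hlt) h1
    apply hi'
    simp only [f, e]
    rw [dif_pos i.2]
  rw [sum_eq_sum_matched_add hM (fun i => -w i), hz, add_zero, ← sum_add_distrib]
  refine sum_le_sum fun j _ => ?_
  have h1 := ht.tight (col j) (hcol j) (by rw [hp]; exact j.2)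
  rw [hp, hA] at h1
  simp only [f]
  split_ifs at h1 ⊢ with hc
  · simp only [Option.elim]
    linarith
  · have := hw _ (hcol j)
    simp only [Option.elim]
    linarith

/-- There are prices that are optimal both with and without an additional taxicab at `v`. -/
theorem IsMarginal.exists_admissible {val : I.Values} {v : Fin I.k} {x : ℝ}
    (h : I.IsMarginal val v x) :
    ∃ (r : I.Prices) (f : Fin I.n → Option (Fin I.m)), Admissible r ∧ IsMatching f ∧
      dualValue I.supply val r = weight I.supply val f ∧ r v = x ∧
      ∀ r', Admissible r' → dualValue I.supply val r + r v ≤ dualValue I.supply val r' + r' v := by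
  obtain ⟨u, w, p, p', hF, hT', hT, rfl⟩ := h
  -- There are `n + 2` zero columns and only `n + 1` rows, so some zero column is free. Its
  -- potential is `0`, and feasibility there makes all row potentials nonpositive, hence the prices
  -- nonnegative.
  have hu : ∀ j < I.n + 1, u j ≤ 0 := by
    have : ∃ c < I.cols, I.m ≤ c ∧ I.n + 1 ≤ p' c := by
      by_contra! hn
      have : #(Finset.Ico I.m I.cols) ≤ #(Finset.range (I.n + 1)) := by
        refine card_le_card_of_injOn p' (fun c hc => ?_) (fun c hc c' hc' e => ?_)
        · simp only [coe_Ico, Set.mem_Ico] at hc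
          simpa using hn c hc.2 hc.1
        · simp only [coe_Ico, Set.mem_Ico] at hc hc'
          exact hT'.inj c hc.2 c' hc'.2 (hn c hc.2 hc.1) e
      simp only [Nat.card_Ico, card_range, cols] at this
      omega
    obtain ⟨c, hc, hmc, hpc⟩ := this
    intro j hj
    have h1 := hF.le j hj c hc
    rw [hT'.free c hc hpc, costMatrix, dif_neg (by omega)] at h1
    linarith
  have hm : I.m ≤ I.cols := by simp only [cols]; omega
  obtain ⟨f, hf, hfw⟩ := exists_matching_of_tight (g := I.supply) (val := val)
    (A := I.costMatrix val v) (fun j c => by simp [costMatrix, rowLoc]) hm hF.nonpos hT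
  obtain ⟨f', hf', hfw'⟩ := exists_matching_of_tight (N := I.n + 1) (g := fun j => I.rowLoc v j)
    (val := val) (A := I.costMatrix val v) (fun j c => by simp [costMatrix]) hm hF.nonpos hT'
  have hne : (univ : Finset (Fin (I.n + 1))).Nonempty := univ_nonempty
  -- The row potentials are extended to all locations by the greatest 1-Lipschitz function bounded
  -- by `-u j` at each row.
  let r : I.Prices := fun x => univ.inf' hne fun j : Fin (I.n + 1) => -u j + I.ℓ (I.rowLoc v j) x
  have hr_le : ∀ x (j : Fin (I.n + 1)), r x ≤ -u j + I.ℓ (I.rowLoc v j) x :=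
    fun x j => inf'_le _ (mem_univ j)
  have hr : Admissible r := by
    constructor
    · intro x
      refine le_inf' hne _ fun j _ => ?_
      have := hu j j.2
      have := I.ℓ_nonneg (I.rowLoc v j) x
      linarith
    · intro x y
      refine le_inf' hne _ fun j _ => ?_
      have h1 := hr_le y j
      have h2 := I.ℓ_triangle (I.rowLoc v j) x y
      linarith
  have hq : ∀ i : Fin I.m, max (val i - r (I.profile i)) 0 ≤ -w i := by
    intro i
    refine max_le ?_ (by have := hF.nonpos i (i.2.trans_le hm); linarith)
    rw [sub_le_comm]
    refine le_inf' hne _ fun j _ => ?_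
    have h1 := hF.le j j.2 i (i.2.trans_le hm)
    rw [costMatrix, dif_pos i.2] at h1
    linarith
  have hq' : ∑ i : Fin I.m, max (val i - r (I.profile i)) 0 ≤ ∑ i : Fin I.m, -w i :=
    sum_le_sum fun i _ => hq i
  have hloc : ∀ j : Fin I.n, I.rowLoc v (j : ℕ) = I.supply j := fun j => by simp [rowLoc]
  have hlocn : I.rowLoc v I.n = v := by simp [rowLoc]
  have hself : ∀ x, I.ℓ x x = 0 := fun x => (I.ℓ_eq_zero x x).2 rfl
  have hs : ∑ j, r (I.supply j) ≤ ∑ j : Fin I.n, -u j := by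
    refine sum_le_sum fun j _ => ?_
    have := hr_le (I.supply j) j.castSucc
    simpa [hloc, hself] using this
  have hv : r v ≤ -u I.n := by
    have := hr_le v (Fin.last I.n)
    simpa [hlocn, hself] using this
  have hsucc : ∀ r' : I.Prices, dualValue (fun j : Fin (I.n + 1) => I.rowLoc v j) val r' =
      dualValue I.supply val r' + r' v := by
    intro r'
    unfold dualValue
    rw [Fin.sum_univ_castSucc]
    simp only [Fin.val_castSucc, Fin.val_last, hloc, hlocn]
    ring
  have hw1 := weight_le_dualValue I.supply val hr hf
  have hw2 := weight_le_dualValue (fun j : Fin (I.n + 1) => I.rowLoc v j) val hr hf'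
  rw [hsucc] at hw2
  rw [Fin.sum_univ_castSucc] at hfw'
  simp only [Fin.val_castSucc, Fin.val_last] at hfw'
  have hD : dualValue I.supply val r ≤ ∑ j : Fin I.n, -u j + ∑ i : Fin I.m, -w i :=
    add_le_add hs hq'
  -- The prices cost no more than the potentials, which the two matchings already attain. Weak
  -- duality turns all these inequalities into equalities, in particular `r v = -u n`.
  refine ⟨r, f, hr, hf, by linarith, by linarith, fun r' hr' => ?_⟩
  have hw3 := weight_le_dualValue (fun j : Fin (I.n + 1) => I.rowLoc v j) val hr' hf'
  rw [hsucc] at hw3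
  linarith

/-- The correctness proof of the program doubles as the existence proof, i.e. as strong duality. -/
theorem exists_isMarginal {val : I.Values} (hval : ∀ i, 0 ≤ val i) (v : Fin I.k) :
    ∃ x, I.IsMarginal val v x := by
  obtain ⟨τ, -, -, -, h⟩ := RAM.prices_ok I val hval
  exact ⟨_, h v⟩

/-! ### The least optimal prices -/

/-- `r` is an optimal solution of the dual problem. -/
def IsOptimal (val : I.Values) (r : I.Prices) : Prop :=
  Admissible r ∧ ∀ r', Admissible r' → dualValue I.supply val r ≤ dualValue I.supply val r'

/-- The least optimal prices. -/
noncomputable def surgePrice (val : I.Values) (v : Fin I.k) : ℝ :=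
  sInf {x | ∃ r, IsOptimal val r ∧ x = r v}

/-- Prices minimizing both `D` and `D + r v` have, among all minimizers of `D`, the least value at
`v`. So `x` does not depend on which potentials were found. -/
theorem IsMarginal.eq_surgePrice {val : I.Values} {v : Fin I.k} {x : ℝ}
    (h : I.IsMarginal val v x) : x = surgePrice val v := by
  obtain ⟨r, f, hr, hf, hD, rfl, hmin⟩ := h.exists_admissible
  have hopt : IsOptimal val r :=
    ⟨hr, fun r' hr' => hD ▸ weight_le_dualValue I.supply val hr' hf⟩
  refine (IsLeast.csInf_eq (s := {x | ∃ r, IsOptimal val r ∧ x = r v})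
    ⟨⟨r, hopt, rfl⟩, ?_⟩).symm
  rintro _ ⟨r', hr', rfl⟩
  have h1 := hmin r' hr'.1
  have h2 := hr'.2 r hr
  linarith

theorem exists_optimal_at {val : I.Values} (hval : ∀ i, 0 ≤ val i) (v : Fin I.k) :
    ∃ r, IsOptimal val r ∧ r v = surgePrice val v ∧
      ∀ r', Admissible r' → dualValue I.supply val r + r v ≤ dualValue I.supply val r' + r' v := by
  obtain ⟨x, hx⟩ := exists_isMarginal hval v
  obtain ⟨r, f, hr, hf, hD, hrv, hmin⟩ := hx.exists_admissible
  exact ⟨r, ⟨hr, fun r' hr' => hD ▸ weight_le_dualValue I.supply val hr' hf⟩,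
    hrv.trans hx.eq_surgePrice, hmin⟩

theorem surgePrice_le {val : I.Values} {r : I.Prices} (h : IsOptimal val r) (v : Fin I.k) :
    surgePrice val v ≤ r v :=
  csInf_le ⟨0, by rintro _ ⟨r, hr, rfl⟩; exact hr.1.nonneg v⟩ ⟨r, h, rfl⟩

theorem admissible_surgePrice {val : I.Values} (hval : ∀ i, 0 ≤ val i) :
    Admissible (surgePrice val) := by
  constructor
  · intro v
    obtain ⟨r, hr, hv, -⟩ := exists_optimal_at hval v
    rw [← hv]
    exact hr.1.nonneg v
  · intro u v
    obtain ⟨r, hr, hu, -⟩ := exists_optimal_at hval u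
    have h1 := surgePrice_le hr v
    have h2 := hr.1.lipschitz u v
    linarith

/-- One optimal matching is complementary to every optimal price vector. Each slackness condition is
then checked with optimal prices that attain the minimum at the single location that matters. -/
theorem exists_complementary {val : I.Values} (hval : ∀ i, 0 ≤ val i) :
    ∃ f, IsMatching f ∧ Complementary val (surgePrice val) f := by
  rcases isEmpty_or_nonempty (Fin I.k) with hk | ⟨⟨v₀⟩⟩
  · exact ⟨fun _ => none, fun j => hk.elim (I.supply j), fun j => hk.elim (I.supply j),
      fun j => hk.elim (I.supply j), fun j => hk.elim (I.supply j),
      fun i => hk.elim (I.profile i)⟩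
  obtain ⟨x, hx⟩ := exists_isMarginal hval v₀
  obtain ⟨r₀, f, hr₀, hf, hD, -, -⟩ := hx.exists_admissible
  have hc : ∀ r, IsOptimal val r → Complementary val r f := by
    intro r hr
    refine (complementary_iff hr.1 hf).2 (le_antisymm ?_ ?_)
    · rw [← hD]; exact hr.2 r₀ hr₀
    · exact weight_le_dualValue I.supply val hr.1 hf
  refine ⟨f, hf, fun j hj => ?_, fun j i hj => ?_, fun j i hj => ?_, fun i hi => ?_⟩
  · obtain ⟨r, hr, hv, -⟩ := exists_optimal_at hval (I.supply j)
    rw [← hv]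
    exact (hc r hr).idle j hj
  · obtain ⟨r, hr, hv, -⟩ := exists_optimal_at hval (I.profile i)
    -- The minimum is taken at the passenger's location; the Lipschitz condition supplies the other
    -- inequality.
    refine le_antisymm ?_ ((admissible_surgePrice hval).lipschitz _ _)
    rw [← hv, ← (hc r hr).moves j i hj]
    exact surgePrice_le hr _
  · obtain ⟨r, hr, hv, -⟩ := exists_optimal_at hval (I.profile i)
    rw [← hv]
    exact (hc r hr).matched j i hj
  · obtain ⟨r, hr, hv, -⟩ := exists_optimal_at hval (I.profile i)
    rw [← hv]
    exact (hc r hr).unmatched i hi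

theorem isOptimal_surgePrice {val : I.Values} (hval : ∀ i, 0 ≤ val i) :
    IsOptimal val (surgePrice val) := by
  obtain ⟨f, hf, hc⟩ := exists_complementary hval
  refine ⟨admissible_surgePrice hval, fun r' hr' => ?_⟩
  rw [(complementary_iff (admissible_surgePrice hval) hf).1 hc]
  exact weight_le_dualValue I.supply val hr' hf

/-! ### Flows -/

theorem mem_taxisAt {s : I.Supply} {v : Fin I.k} {j : Fin I.n} : j ∈ taxisAt s v ↔ s j = v := by
  simp [taxisAt]

theorem sum_card_mul (s : I.Supply) (r : I.Prices) :
    ∑ v, (#(taxisAt s v) : ℝ) * r v = ∑ j, r (s j) := by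
  rw [← sum_fiberwise univ s]
  refine sum_congr rfl fun v _ => ?_
  rw [sum_congr rfl (g := fun _ => r v) fun j hj => by rw [(mem_filter.1 hj).2]]
  simp [taxisAt]

theorem sum_flow_slack {s s' : I.Supply} {g : Fin I.k → Fin I.k → ℕ} (hg : IsFlow s s' g)
    (r : I.Prices) :
    ∑ u, ∑ v, (g u v : ℝ) * (r u - r v + I.ℓ u v) =
      ∑ j, r (s j) - ∑ j, r (s' j) + flowCost g := by
  have h1 : ∑ u, ∑ v, (g u v : ℝ) * r u = ∑ j, r (s j) := by
    rw [← sum_card_mul]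
    refine sum_congr rfl fun u _ => ?_
    rw [← sum_mul, ← hg.1 u]
    push_cast
    rfl
  have h2 : ∑ u, ∑ v, (g u v : ℝ) * r v = ∑ j, r (s' j) := by
    rw [← sum_card_mul, sum_comm]
    refine sum_congr rfl fun v _ => ?_
    rw [← sum_mul, ← hg.2 v]
    push_cast
    rfl
  rw [← h1, ← h2, flowCost]
  simp only [mul_add, mul_sub, sum_add_distrib, sum_sub_distrib]

/-- The easy half of Kantorovich duality: each unit of flow pays at least the price difference. -/
theorem sum_sub_sum_le_flowCost {s s' : I.Supply} {g : Fin I.k → Fin I.k → ℕ} (hg : IsFlow s s' g)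
    {r : I.Prices} (hr : Admissible r) : ∑ j, r (s' j) - ∑ j, r (s j) ≤ flowCost g := by
  have h1 := sum_flow_slack hg r
  have h2 : 0 ≤ ∑ u, ∑ v, (g u v : ℝ) * (r u - r v + I.ℓ u v) :=
    sum_nonneg fun u _ => sum_nonneg fun v _ =>
      mul_nonneg (Nat.cast_nonneg _) (by have := hr.lipschitz u v; linarith)
  linarith

/-- The flow in which every taxicab moves from its old to its new location. -/
def moveFlow (s s' : I.Supply) (u v : Fin I.k) : ℕ := #{j | s j = u ∧ s' j = v}

theorem isFlow_moveFlow (s s' : I.Supply) : IsFlow s s' (moveFlow s s') := by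
  constructor
  · intro u
    rw [taxisAt, card_eq_sum_card_fiberwise (f := s') (t := univ) fun _ _ => by simp]
    simp only [moveFlow, filter_filter]
  · intro v
    rw [taxisAt, card_eq_sum_card_fiberwise (f := s) (t := univ) fun _ _ => by simp]
    simp only [moveFlow, filter_filter, and_comm]

theorem flowCost_moveFlow (s s' : I.Supply) :
    flowCost (moveFlow s s') = ∑ j, I.ℓ (s j) (s' j) := by
  have h := sum_fiberwise univ (fun j => (s j, s' j)) fun j => I.ℓ (s j) (s' j)
  rw [← h, Fintype.sum_prod_type, flowCost]
  refine sum_congr rfl fun u _ => sum_congr rfl fun v _ => ?_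
  rw [sum_congr rfl (g := fun _ => I.ℓ u v) fun j hj => by
    have := (mem_filter.1 hj).2
    rw [Prod.mk.injEq] at this
    rw [this.1, this.2]]
  simp [moveFlow]

theorem sum_sub_sum_le_earthmover (s s' : I.Supply) {r : I.Prices} (hr : Admissible r) :
    ∑ j, r (s' j) - ∑ j, r (s j) ≤ earthmover s s' := by
  refine le_csInf ⟨_, _, isFlow_moveFlow s s', rfl⟩ ?_
  rintro _ ⟨g, hg, rfl⟩
  exact sum_sub_sum_le_flowCost hg hr

theorem earthmover_le (s s' : I.Supply) : earthmover s s' ≤ ∑ j, I.ℓ (s j) (s' j) := by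
  rw [← flowCost_moveFlow]
  refine csInf_le ⟨0, ?_⟩ ⟨_, isFlow_moveFlow s s', rfl⟩
  rintro _ ⟨g, -, rfl⟩
  exact sum_nonneg fun u _ => sum_nonneg fun v _ => mul_nonneg (Nat.cast_nonneg _) (I.ℓ_nonneg u v)

/-! ### The outcome -/

theorem sum_served_price (S : Finset (Fin I.m)) (r : I.Prices) :
    ∑ i ∈ S, r (I.profile i) = ∑ v, (#{i ∈ S | I.profile i = v} : ℝ) * r v := by
  rw [← sum_fiberwise S I.profile]
  refine sum_congr rfl fun v _ => ?_
  rw [sum_congr rfl (g := fun _ => r v) fun j hj => by rw [(mem_filter.1 hj).2]]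
  simp

/-- Weak duality: the dual value bounds the social welfare. -/
theorem socialWelfare_le_dualValue {val : I.Values} {r : I.Prices} (hr : Admissible r)
    {s₁ : I.Supply} {S : Finset (Fin I.m)}
    (hS : ∀ v, #{i ∈ S | I.profile i = v} ≤ #(taxisAt s₁ v)) :
    socialWelfare val I.supply s₁ S ≤ dualValue I.supply val r := by
  have h1 := sum_sub_sum_le_earthmover I.supply s₁ hr
  have h2 : ∑ i ∈ S, r (I.profile i) ≤ ∑ j, r (s₁ j) := by
    rw [sum_served_price, ← sum_card_mul]
    exact sum_le_sum fun v _ =>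
      mul_le_mul_of_nonneg_right (by exact_mod_cast hS v) (hr.nonneg v)
  have h3 : ∑ i ∈ S, val i ≤ ∑ i ∈ S, (r (I.profile i) + max (val i - r (I.profile i)) 0) :=
    sum_le_sum fun i _ => by linarith [le_max_left (val i - r (I.profile i)) 0]
  have h4 : ∑ i ∈ S, max (val i - r (I.profile i)) 0 ≤ ∑ i, max (val i - r (I.profile i)) 0 :=
    sum_le_sum_of_subset_of_nonneg (subset_univ S) fun i _ _ => le_max_right _ _
  rw [sum_add_distrib] at h3
  unfold socialWelfare dualValue
  linarith

/-- The supply after the matched taxicabs have moved to their passengers. -/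
def target (f : Fin I.n → Option (Fin I.m)) : I.Supply := fun j => (f j).elim (I.supply j) I.profile

section Outcome

variable {val : I.Values} {r : I.Prices} {f : Fin I.n → Option (Fin I.m)}

theorem Complementary.target_eq (hc : Complementary val r f) (j : Fin I.n) :
    r (I.supply j) = r (target f j) - I.ℓ (I.supply j) (target f j) := by
  unfold target
  cases h : f j with
  | none => simp [(I.ℓ_eq_zero _ _).2 rfl]
  | some i => exact hc.moves j i h

/-- Idle taxicabs only stand where the price is `0`, so at a positive price every taxicab has its
own passenger from the demand. -/
theorem Complementary.card_taxisAt_le (hc : Complementary val r f) (hf : IsMatching f)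
    {v : Fin I.k} (hv : r v ≠ 0) : #(taxisAt (target f) v) ≤ #(demand val r v) := by
  have key : ∀ j ∈ taxisAt (target f) v, ∃ i ∈ demand val r v, f j = some i := by
    intro j hj
    rw [mem_taxisAt, target] at hj
    cases h : f j with
    | none =>
      rw [h] at hj
      simp only [Option.elim] at hj
      exact absurd (hj ▸ hc.idle j h) hv
    | some i =>
      rw [h] at hj
      simp only [Option.elim] at hj
      exact ⟨i, by simp [demand, hj, hj ▸ hc.matched j i h], rfl⟩
  have h1 : (taxisAt (target f) v).image f ⊆ (demand val r v).image some := by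
    intro o ho
    obtain ⟨j, hj, rfl⟩ := mem_image.1 ho
    obtain ⟨i, hi, e⟩ := key j hj
    exact mem_image.2 ⟨i, hi, e.symm⟩
  have h2 : #((taxisAt (target f) v).image f) = #(taxisAt (target f) v) := by
    refine card_image_of_injOn fun j hj j' _ e => ?_
    obtain ⟨i, -, hi⟩ := key j hj
    exact hf j j' i hi (e ▸ hi)
  rw [← h2]
  exact (card_le_card h1).trans card_image_le

theorem Complementary.min_mul (hc : Complementary val r f) (hf : IsMatching f) (v : Fin I.k) :
    ((min #(demand val r v) #(taxisAt (target f) v) : ℕ) : ℝ) * r v =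
      (#(taxisAt (target f) v) : ℝ) * r v := by
  by_cases hv : r v = 0
  · simp [hv]
  · rw [min_eq_right (hc.card_taxisAt_le hf hv)]

/-- The service rate is `1` wherever the price is nonzero, so it drops out of the utility. -/
theorem Complementary.taxiUtility_eq (hc : Complementary val r f) (hf : IsMatching f)
    (u v : Fin I.k) : taxiUtility val r (target f) u v = r v - I.ℓ u v := by
  unfold taxiUtility serviceRate
  split_ifs with h
  · rw [one_mul]
  · have h' : (#(taxisAt (target f) v) : ℝ) ≠ 0 := by exact_mod_cast h
    rw [div_mul_eq_mul_div, hc.min_mul hf, mul_div_cancel_left₀ _ h']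

theorem Complementary.card_above_le (hc : Complementary val r f) (v : Fin I.k) :
    #{i | I.profile i = v ∧ r v < val i} ≤ #(taxisAt (target f) v) := by
  have key : ∀ i ∈ ({i | I.profile i = v ∧ r v < val i} : Finset (Fin I.m)),
      ∃ j ∈ taxisAt (target f) v, f j = some i := by
    intro i hi
    simp only [mem_filter, mem_univ, true_and] at hi
    by_contra! hn
    have hu : ∀ j, f j ≠ some i := by
      intro j hj
      exact hn j (by simp [mem_taxisAt, target, hj, hi.1]) hj
    have := hc.unmatched i hu
    rw [hi.1] at this
    linarith [hi.2]
  have h1 : ({i | I.profile i = v ∧ r v < val i} : Finset (Fin I.m)).image some ⊆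
      (taxisAt (target f) v).image f := by
    intro o ho
    obtain ⟨i, hi, rfl⟩ := mem_image.1 ho
    obtain ⟨j, hj, e⟩ := key i hi
    exact mem_image.2 ⟨j, hj, e⟩
  rw [← card_image_of_injective _ (Option.some_injective (Fin I.m))]
  exact (card_le_card h1).trans card_image_le

theorem Complementary.mem_of_lt (hc : Complementary val r f) {S : Finset (Fin I.m)}
    (hS : IsDemandServed val r (target f) S) {i : Fin I.m} (hi : r (I.profile i) < val i) :
    i ∈ S := by
  by_contra hn
  obtain ⟨h1, h2, h3⟩ := hS (I.profile i)
  have hid : i ∈ demand val r (I.profile i) := by simp [demand, hi.le]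
  have hsub : ({x ∈ S | I.profile x = I.profile i} : Finset (Fin I.m)) ⊂
      demand val r (I.profile i) := by
    refine ⟨h1, fun h => hn ?_⟩
    exact (mem_filter.1 (h hid)).1
  have hlt := card_lt_card hsub
  have hsub' : ({x ∈ S | I.profile x = I.profile i} : Finset (Fin I.m)) ⊂
      -- If `i` were left out, everyone served at this location would be valued at least as highly,
      -- hence above the price. The served would then be fewer than both the demand and the
      -- taxicabs, contradicting the minimum.
      ({x | I.profile x = I.profile i ∧ r (I.profile i) < val x} : Finset (Fin I.m)) := by
    refine ⟨fun x hx => ?_, fun h => hn ?_⟩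
    · obtain ⟨hxS, hx⟩ := mem_filter.1 hx
      have := h3 x hxS hx i hid hn
      simp only [mem_filter, mem_univ, true_and]
      exact ⟨hx, by linarith⟩
    · exact (mem_filter.1 (h (by simp [hi]))).1
  have hlt' := card_lt_card hsub'
  have h4 := hc.card_above_le (I.profile i)
  omega

theorem IsDemandServed.le_of_mem {s' : I.Supply} {S : Finset (Fin I.m)}
    (hS : IsDemandServed val r s' S) {i : Fin I.m} (hi : i ∈ S) : r (I.profile i) ≤ val i := by
  have := (hS (I.profile i)).1 (mem_filter.2 ⟨hi, rfl⟩)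
  simpa [demand] using this

theorem IsDemandServed.card_le {s' : I.Supply} {S : Finset (Fin I.m)}
    (hS : IsDemandServed val r s' S) (v : Fin I.k) :
    #{i ∈ S | I.profile i = v} ≤ #(taxisAt s' v) := by
  rw [(hS v).2.1]
  exact min_le_right _ _

/-- By the Lipschitz condition no move from `u` earns more than `r u`. The flow moving taxicabs to
`target f` has total slack `0`; a min cost flow costs no more, so each of its used edges earns
exactly `r u`. -/
theorem Complementary.isEquilibrium (hc : Complementary val r f) (hr : Admissible r)
    (hf : IsMatching f) : IsEquilibrium val I.supply (target f) r := by
  refine ⟨fun g hg u v huv w => ?_, fun S hS i hi => hc.mem_of_lt hS hi,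
    fun S hS i hi hn => absurd (hS.le_of_mem hn) (not_le.2 hi)⟩
  have hcost : flowCost g ≤ ∑ j, I.ℓ (I.supply j) (target f j) := by
    rw [← flowCost_moveFlow]
    exact hg.2 _ (isFlow_moveFlow _ _)
  have hsum := sum_flow_slack hg.1 r
  have h0 : ∑ j, r (I.supply j) - ∑ j, r (target f j) + ∑ j, I.ℓ (I.supply j) (target f j) = 0 := by
    rw [sum_congr rfl fun j _ => hc.target_eq j, sum_sub_distrib]
    ring
  have hnn : ∀ u v, 0 ≤ (g u v : ℝ) * (r u - r v + I.ℓ u v) := fun u v =>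
    mul_nonneg (Nat.cast_nonneg _) (by have := hr.lipschitz u v; linarith)
  have hz : ∑ u, ∑ v, (g u v : ℝ) * (r u - r v + I.ℓ u v) = 0 :=
    le_antisymm (by linarith) (sum_nonneg fun u _ => sum_nonneg fun v _ => hnn u v)
  rw [sum_eq_zero_iff_of_nonneg fun u _ => sum_nonneg fun v _ => hnn u v] at hz
  have hz' := hz u (mem_univ u)
  rw [sum_eq_zero_iff_of_nonneg fun v _ => hnn u v] at hz'
  have hg' : (g u v : ℝ) ≠ 0 := by exact_mod_cast huv.ne'
  have h1 := (mul_eq_zero.1 (hz' v (mem_univ v))).resolve_left hg'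
  have h2 := hr.lipschitz u w
  rw [hc.taxiUtility_eq hf, hc.taxiUtility_eq hf]
  linarith

theorem Complementary.dualValue_le_socialWelfare (hc : Complementary val r f) (hf : IsMatching f)
    {S : Finset (Fin I.m)} (hS : IsDemandServed val r (target f) S) :
    dualValue I.supply val r ≤ socialWelfare val I.supply (target f) S := by
  have h1 := earthmover_le I.supply (target f)
  have h2 : ∑ j, r (I.supply j) = ∑ j, r (target f j) - ∑ j, I.ℓ (I.supply j) (target f j) := by
    rw [sum_congr rfl fun j _ => hc.target_eq j, sum_sub_distrib]
  have h3 : ∑ i ∈ S, r (I.profile i) = ∑ j, r (target f j) := by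
    rw [sum_served_price, ← sum_card_mul]
    refine sum_congr rfl fun v _ => ?_
    rw [(hS v).2.1, hc.min_mul hf]
  have h4 : ∑ i, max (val i - r (I.profile i)) 0 = ∑ i ∈ S, (val i - r (I.profile i)) := by
    -- Ties do not matter: passengers valued exactly at the price have surplus `0`.
    rw [← sum_subset (subset_univ S) fun i _ hi => ?_]
    · exact sum_congr rfl fun i hi => max_eq_left (by linarith [hS.le_of_mem hi])
    · refine max_eq_right ?_
      by_contra! hlt
      exact hi (hc.mem_of_lt hS (by linarith))
  rw [sum_sub_distrib] at h4
  unfold dualValue socialWelfare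
  linarith

end Outcome

/-! ### Welfare as a function of one report -/

/-- At nonnegative prices report `0` contributes no surplus, so it represents the absence of
passenger `i`. -/
theorem dualValue_update (val : I.Values) (i : Fin I.m) (x : ℝ) {r : I.Prices}
    (hr : Admissible r) :
    dualValue I.supply (Function.update val i x) r =
      dualValue I.supply (Function.update val i 0) r + max (x - r (I.profile i)) 0 := by
  unfold dualValue
  rw [← add_sum_erase univ _ (mem_univ i),
    ← add_sum_erase univ (fun j => max (Function.update val i 0 j - r (I.profile j)) 0)
      (mem_univ i)]
  have h1 : ∀ y, ∑ j ∈ univ.erase i, max (Function.update val i y j - r (I.profile j)) 0 =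
      ∑ j ∈ univ.erase i, max (val j - r (I.profile j)) 0 := fun y =>
    sum_congr rfl fun j hj => by rw [Function.update_of_ne (ne_of_mem_erase hj)]
  rw [h1, h1]
  simp only [Function.update_self]
  rw [max_eq_right (by linarith [hr.nonneg (I.profile i)] : (0 : ℝ) - r (I.profile i) ≤ 0)]
  ring

/-- The gain in welfare from the report `x` of passenger `i` is at most the utility of `i` at the
least optimal prices. -/
theorem dualValue_sub_le {val : I.Values} (hval : ∀ i, 0 ≤ val i) (i : Fin I.m) {x : ℝ}
    (hx : 0 ≤ x) :
    dualValue I.supply (Function.update val i x) (surgePrice (Function.update val i x)) -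
      dualValue I.supply (Function.update val i 0) (surgePrice (Function.update val i 0)) ≤
      max (x - surgePrice (Function.update val i x) (I.profile i)) 0 := by
  have hup : ∀ y : ℝ, 0 ≤ y → ∀ j, 0 ≤ Function.update val i y j := by
    intro y hy j
    rw [Function.update_apply]
    split_ifs
    · exact hy
    · exact hval j
  have h0 := admissible_surgePrice (hup 0 le_rfl)
  obtain ⟨r, hr, hv, hmin⟩ := exists_optimal_at (hup x hx) (I.profile i)
  have h1 := hmin _ h0
  have h2 := (isOptimal_surgePrice (hup x hx)).2 _ h0
  have h3 := (isOptimal_surgePrice (hup x hx)).2 _ hr.1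
  rw [dualValue_update val i x h0] at h1 h2
  rw [hv] at h1
  -- If `x` does not exceed the price found without `i`, those prices show that the report gains
  -- nothing. Otherwise, in the comparison with an additional taxicab at the location of `i`, the
  -- surplus `x - r₀` and the price `r₀` of that taxicab add up to `x`.
  rcases le_total (x - surgePrice (Function.update val i 0) (I.profile i)) 0 with h | h
  · rw [max_eq_right h] at h2
    exact le_max_of_le_right (by linarith)
  · rw [max_eq_left h] at h1
    exact le_max_of_le_left (by linarith)

end Setting

/-! ### The mechanism and its truthfulness -/

open Setting Classical in
/-- The mechanism: the least optimal prices and a welfare maximizing supply. -/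
noncomputable def surgeMechanism : Mechanism where
  price _ val := surgePrice val
  newSupply I val :=
    if h : ∃ f, IsMatching f ∧ Complementary val (surgePrice val) f then target h.choose
    else I.supply

open Setting

theorem surgeMechanism_newSupply {I : Setting} {val : I.Values} (hval : ∀ i, 0 ≤ val i) :
    ∃ f, IsMatching f ∧ Complementary val (surgePrice val) f ∧
      surgeMechanism.newSupply I val = target f := by
  have h := exists_complementary hval
  exact ⟨h.choose, h.choose_spec.1, h.choose_spec.2, dif_pos h⟩

theorem surgeMechanism_pricesPolyTime : surgeMechanism.PricesPolyTime := by
  refine ⟨RAM.prices, RAM.pricePoly, fun I val hval => ?_⟩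
  obtain ⟨τ, t, hrun, ht, hτ⟩ := RAM.prices_ok I val hval
  exact ⟨τ, t, hrun, ht.trans (RAM.le_pricePoly I.k I.m I.n), fun v => (hτ v).eq_surgePrice⟩

theorem surgeMechanism_isTruthful : surgeMechanism.IsTruthful := by
  intro I val hval i x y hx hy S S₁ hS hS₁
  have hup : ∀ y : ℝ, 0 ≤ y → ∀ j, 0 ≤ Function.update val i y j := by
    intro y hy j
    rw [Function.update_apply]
    split_ifs
    · exact hy
    · exact hval j
  obtain ⟨f, hf, hc, he⟩ := surgeMechanism_newSupply (hup x hx)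
  obtain ⟨f₁, hf₁, hc₁, he₁⟩ := surgeMechanism_newSupply (hup y hy)
  rw [he] at hS
  rw [he₁] at hS₁
  change IsDemandServed _ (surgePrice _) _ _ at hS hS₁
  change passengerUtility (surgePrice _) S₁ i x ≤ passengerUtility (surgePrice _) S i x
  have hax := admissible_surgePrice (hup x hx)
  have hay := admissible_surgePrice (hup y hy)
  have hopt := isOptimal_surgePrice (hup 0 le_rfl)
  have truth : max (x - surgePrice (Function.update val i x) (I.profile i)) 0 ≤
      passengerUtility (surgePrice (Function.update val i x)) S i x := by
    unfold passengerUtility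
    split_ifs with h
    · have := hS.le_of_mem h
      rw [Function.update_self] at this
      exact max_le le_rfl (by linarith)
    · refine max_le ?_ le_rfl
      by_contra! hlt
      exact h (hc.mem_of_lt hS (by rw [Function.update_self]; linarith))
  -- It remains to bound the utility after the misreport by the welfare gained through the report
  -- `x`.
  refine le_trans ?_ ((dualValue_sub_le hval i hx).trans truth)
  unfold passengerUtility
  split_ifs with h
  -- If served under `y`, the misreported outcome is evaluated with the value `x` instead: its
  -- welfare is at least the optimum without `i` plus `x` minus the price paid, and at most the
  -- optimum with `x`.
  · have h1 := hc₁.dualValue_le_socialWelfare hf₁ hS₁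
    have h2 := socialWelfare_le_dualValue (val := Function.update val i x) hax hS₁.card_le
    have h3 : ∀ z : ℝ, ∑ j ∈ S₁, Function.update val i z j = z + ∑ j ∈ S₁.erase i, val j := by
      intro z
      rw [← add_sum_erase S₁ _ h, Function.update_self]
      congr 1
      exact sum_congr rfl fun j hj => Function.update_of_ne (ne_of_mem_erase hj) _ _
    unfold socialWelfare at h1 h2
    rw [h3] at h1 h2
    rw [dualValue_update val i y hay] at h1
    have h4 := hopt.2 _ hay
    have h5 := le_max_left (y - surgePrice (Function.update val i y) (I.profile i)) 0
    linarith
  -- If not served, it suffices that the gain from the report `x` is nonnegative.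
  · rw [dualValue_update val i x hax]
    have h4 := hopt.2 _ hax
    have h5 := le_max_right (x - surgePrice (Function.update val i x) (I.profile i)) 0
    linarith

end Taxi

theorem theorem3 :
    ∃ M : Taxi.Mechanism,
      (∀ (I : Taxi.Setting) (val : I.Values), (∀ i, 0 ≤ val i) →
        (∀ v, 0 ≤ M.price I val v) ∧
        Taxi.Setting.IsEquilibrium val I.supply (M.newSupply I val) (M.price I val) ∧
        Taxi.Setting.MaximizesWelfare val I.supply (M.newSupply I val) (M.price I val)) ∧
      M.PricesPolyTime ∧
      M.IsTruthful := by
  refine ⟨Taxi.surgeMechanism, fun I val hval => ?_, Taxi.surgeMechanism_pricesPolyTime,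
    Taxi.surgeMechanism_isTruthful⟩
  obtain ⟨f, hf, hc, he⟩ := Taxi.surgeMechanism_newSupply hval
  have hr := Taxi.Setting.admissible_surgePrice hval
  rw [he]
  refine ⟨hr.nonneg, hc.isEquilibrium hr hf, fun S hS s₁ r₁ S₁ _ hS₁ => ?_⟩
  exact (Taxi.Setting.socialWelfare_le_dualValue hr hS₁.card_le).trans
    (hc.dualValue_le_socialWelfare hf hS)
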